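/- **Setting.** A random oracle with query set $X$ and finite nonempty answer sets $Y_x$ ($x\in X$) is a random function $\mathcal O$ whose values $\mathcal O(x)$, $x\in X$, are independent and uniformly distributed on $Y_x$ (for instance $X=\{0,1\}^*$ and $Y_x=\{0,1\}^{|x|}$). Algorithms are computationally unbounded and are charged only for their oracle queries. An oracle signature scheme for a finite message space $\mathcal M$ consists of a probabilistic oracle algorithm $\mathsf{Gen}$, which outputs a signing key and a verification key $(SK,VK)$, and deterministic oracle algorithms $\mathsf{Sign}$ and $\mathsf{Ver}$. It has perfect completeness if for every oracle $\mathcal O$, every pair $(SK,VK)$ that $\mathsf{Gen}^{\mathcal O}$ outputs with positive probability, and every $\alpha\in\mathcal M$, one has $\mathsf{Ver}^{\mathcal O}(VK,\alpha,\mathsf{Sign}^{\mathcal O}(SK,\alpha))=1$. It asks at most $q$ queries in total if for every oracle, all coins of $\mathsf{Gen}$ of positive probability and every $\alpha\in\mathcal M$, generating $(SK,VK)$, computing $\sigma=\mathsf{Sign}^{\mathcal O}(SK,\alpha)$ and running $\mathsf{Ver}^{\mathcal O}(VK,\alpha,\sigma)$ together take at most $q$ oracle queries. A (one-time) adversary consists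 of a message $\alpha\in\mathcal M$, fixed independently of the keys, and a probabilistic oracle algorithm $A$. It breaks the scheme with probability at least $p$ if $$\Pr\big[\alpha^*\neq\alpha \text{ and } \mathsf{Ver}^{\mathcal O}(VK,\alpha^*,\sigma^*)=1\big]\ \ge\ p,\qquad (SK,VK)=\mathsf{Gen}^{\mathcal O},\quad (\alpha^*,\sigma^*)=A^{\mathcal O}(VK,\mathsf{Sign}^{\mathcal O}(SK,\alpha)),$$ where the probability is over the random oracle $\mathcal O$ and the coins of $\mathsf{Gen}$ and $A$. **Theorem.** There is an absolute constant $C>0$ such that the following holds. Let $(\mathsf{Gen},\mathsf{Sign},\mathsf{Ver})$ be an oracle signature scheme with perfect completeness for a finite message space $\mathcal M$, in the random oracle model, which asks at most $q\ge 0$ oracle queries in total. Let $\lambda,\delta>0$ be real numbers with $$|\mathcal M|\ \ge\ \frac1\lambda\binom{q}{\lfloor q/2\rfloor}.$$ Then there is a computationally unbounded one-time adversary which on every input, for all its coins and with every oracle, asks at most $T$ oracle queries, where $$T\le C\,\frac{q^{2}\binom{q}{\lfloor q/2\rfloor}}{\lambda\delta^{2}}\qquad\text{and}\qquad T\le C\,\frac{q^{3/2}\,2^{q}}{\lambda\delta^{2}},$$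 and which breaks the scheme with probability at least $1-(\lambda+\delta)$. -/

import Mathlib

open MeasureTheory
open scoped ENNReal

universe u v w₁ w₂ w₃ w₄

/-- An oracle with query set `X`: to the query `x : X` it gives an answer in `Y x`. -/
def Oracle (X : Type u) (Y : X → Type v) : Type (max u v) := ∀ x, Y x

/-- The product of the discrete sigma-algebras on the answer sets. -/
instance Oracle.instMeasurableSpace (X : Type u) (Y : X → Type v) :
    MeasurableSpace (Oracle X Y) :=
  @MeasurableSpace.pi X Y (fun _ => ⊤)

/-- The random oracle: the answers to distinct queries are independent, and the answer to `x`
is uniformly distributed on the finite set `Y x`. -/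
noncomputable def randomOracle (X : Type u) (Y : X → Type v)
    [∀ x, Fintype (Y x)] [∀ x, Nonempty (Y x)] : Measure (Oracle X Y) :=
  @Measure.infinitePi X Y (fun _ => ⊤)
    (fun x => @PMF.toMeasure (Y x) ⊤ (PMF.uniformOfFintype (Y x)))

/-- A deterministic, computationally unbounded oracle algorithm with output in `A`, given as its
decision tree: it either halts with an output, or asks a query and continues, depending on the
answer. -/
inductive OracleAlg (X : Type u) (Y : X → Type v) (A : Type w₁) : Type (max u v w₁)
  | output (a : A) : OracleAlg X Y A
  | query (x : X) (next : Y x → OracleAlg X Y A) : OracleAlg X Y A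

namespace OracleAlg

variable {X : Type u} {Y : X → Type v} {A : Type w₁}

/-- The output of the algorithm when it is run with the oracle `O`. -/
def run (O : Oracle X Y) : OracleAlg X Y A → A
  | output a => a
  | query x next => run O (next (O x))

/-- The number of oracle queries (counted with repetition) asked in the run with oracle `O`. -/
def numQueries (O : Oracle X Y) : OracleAlg X Y A → ℕ
  | output _ => 0
  | query x next => numQueries O (next (O x)) + 1

end OracleAlg

/-- A probabilistic oracle algorithm: tossing all coins in advance selects, at random, a
deterministic oracle algorithm. -/
abbrev ProbOracleAlg (X : Type u) (Y : X → Type v) (A : Type w₁) : Type (max u v w₁) :=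
  PMF (OracleAlg X Y A)

/-- The three algorithms of an oracle signature scheme for the message space `M`, with signing
keys in `SK`, verification keys in `VK` and signatures in `Sig`. Key generation is probabilistic;
signing and verification are deterministic. -/
structure OracleSigScheme (X : Type u) (Y : X → Type v)
    (M : Type w₁) (SK : Type w₂) (VK : Type w₃) (Sig : Type w₄) where
  gen : ProbOracleAlg X Y (SK × VK)
  sign : SK → M → OracleAlg X Y Sig
  ver : VK → M → Sig → OracleAlg X Y Bool

/-- A one-time chosen-message forger: the message whose signature it requests, and the
probabilistic oracle algorithm which, on input the verification key and the signature of this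
message, outputs a message and a candidate signature. -/
structure Forger (X : Type u) (Y : X → Type v)
    (M : Type w₁) (VK : Type w₃) (Sig : Type w₄) where
  msg : M
  forge : VK → Sig → ProbOracleAlg X Y (M × Sig)

/-- The forger asks at most `T` oracle queries, on every input, for all coins of positive
probability and with every oracle. -/
def Forger.QueriesAtMost {X : Type u} {Y : X → Type v}
    {M : Type w₁} {VK : Type w₃} {Sig : Type w₄} (F : Forger X Y M VK Sig) (T : ℕ) : Prop :=
  ∀ (vk : VK) (σ : Sig), ∀ a ∈ (F.forge vk σ).support, ∀ O : Oracle X Y, a.numQueries O ≤ T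

namespace OracleSigScheme

variable {X : Type u} {Y : X → Type v}
  {M : Type w₁} {SK : Type w₂} {VK : Type w₃} {Sig : Type w₄}

/-- For every oracle, every key pair generated with positive probability and every message, the
honest signature is accepted. -/
def PerfectlyComplete (S : OracleSigScheme X Y M SK VK Sig) : Prop :=
  ∀ O : Oracle X Y, ∀ g ∈ S.gen.support, ∀ α : M,
    (S.ver (g.run O).2 α ((S.sign (g.run O).1 α).run O)).run O = true

/-- For every oracle, all coins of positive probability and every message: generating the keys,
signing the message and verifying this signature takes at most `q` oracle queries in total. -/
def QueriesAtMost (S : OracleSigScheme X Y M SK VK Sig) (q : ℕ) : Prop :=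
  ∀ O : Oracle X Y, ∀ g ∈ S.gen.support, ∀ α : M,
    g.numQueries O + (S.sign (g.run O).1 α).numQueries O
      + (S.ver (g.run O).2 α ((S.sign (g.run O).1 α).run O)).numQueries O ≤ q

open Classical in
/-- The probability that the forger, given the verification key and the signature of its
requested message, outputs an accepted signature on a different message. The probability is over
the random oracle, the coins of key generation and the coins of the forger. -/
noncomputable def breakProb [∀ x, Fintype (Y x)] [∀ x, Nonempty (Y x)]
    (S : OracleSigScheme X Y M SK VK Sig) (F : Forger X Y M VK Sig) : ℝ≥0∞ :=
  ∫⁻ O, ∑' g, S.gen g *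
    (let sk := (g.run O).1
     let vk := (g.run O).2
     let σ := (S.sign sk F.msg).run O
     ∑' a, F.forge vk σ a *
      (let α' := (a.run O).1
       let σ' := (a.run O).2
       if α' ≠ F.msg ∧ (S.ver vk α' σ').run O = true then 1 else 0))
    ∂(randomOracle X Y)

end OracleSigScheme

/-! Fix a set `MS` of n messages and an execution: the coins of key generation and an oracle. For a
message α let Q(α) be the queries of key generation and of signing α (`secret`), and V(α) those of
verifying the honest signature (`verSet`). Call α blocked if V(j) meets Q(α) \ V(α) for every other
j in `MS`. The pairs V(α), Q(α) \ V(α) over blocked α satisfy the hypotheses of the Bollobás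
set-pair inequality, with total size at most q. So in every execution at most N = `q.choose (q / 2)`
messages are blocked, and some fixed α is blocked with probability at most N / n ≤ λ.

The forger holding the signature of α verifies it, picks a hypothetical execution R' consistent with
all it knows, and runs R' on all messages of `MS`, answering the queries in Q'(α) as R' does and all
others by the real oracle. If some j ≠ α has a V'(j) that meets Q'(α) only in known positions, the
signature of j made by R' is valid for the real oracle. Such a j exists if α is not blocked for the
mixed execution, provided the latter asks no unknown secret query of the real execution R. To
compare the mixed execution with a typical one, exchange the oracles of R and R' outside the known
and the secret positions. This is an involution that preserves weights on pairs of indistinguishable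
executions (`sum_swap`). Hence the failure probability is at most that of `Blocked` plus that of a
hit, meaning that a typical R' asks an unknown secret query of R (`sum_fail_attack_le`).

If hits are likely, the forger asks all queries of a suitable R', which lowers the expected number
of unknown secret queries by the hit probability (`exists_learn`). That number starts at most at q,
so t + 1 rounds give failure at most q / (t + 1) plus the probability of being blocked
(`exists_forger_of_rel`). At each round an optimal R' replaces a random one.

All this is finite counting: finitely many coins carry all but η of the probability, and their
honest executions involve only finitely many queries. The resulting family of decision trees is then
transferred to the infinite random oracle (`le_breakProb_of_family`). -/

/-! ### Decision trees: locality of runs, patched oracles, recorded transcripts. -/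

namespace OracleAlg

open scoped Classical

variable {X : Type u} {Y : X → Type v} {A : Type w₁} {B : Type w₂}

/-- The set of queries asked in the run with oracle `O`. -/
noncomputable def queries (O : Oracle X Y) : OracleAlg X Y A → Finset X
  | output _ => ∅
  | query x next => insert x (queries O (next (O x)))

/-- Sequential composition of oracle algorithms. -/
def bind : OracleAlg X Y A → (A → OracleAlg X Y B) → OracleAlg X Y B
  | output a, f => f a
  | query x next, f => query x fun y => bind (next y) f

/-- The algorithm that answers the queries in `K` itself, according to `O'`. -/
noncomputable def override (K : Set X) (O' : Oracle X Y) : OracleAlg X Y A → OracleAlg X Y A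
  | output a => output a
  | query x next =>
    if x ∈ K then override K O' (next (O' x)) else query x fun y => override K O' (next y)

/-- Run an algorithm, enter the answers into the table `O₀`, and continue depending on the
resulting table. -/
noncomputable def record (f : Oracle X Y → OracleAlg X Y B) :
    OracleAlg X Y A → Oracle X Y → OracleAlg X Y B
  | output _, O₀ => f O₀
  | query x next, O₀ => query x fun y => record f (next y) (Function.update O₀ x y)

/-- Halt with output `d` instead of asking more than `n` queries. -/
def truncate (d : A) : ℕ → OracleAlg X Y A → OracleAlg X Y A
  | _, output a => output a
  | 0, query _ _ => output d
  | n + 1, query x next => query x fun y => truncate d n (next y)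

/-- Ask all queries in a list. -/
def askAll : List X → OracleAlg X Y PUnit.{1}
  | [] => output ⟨⟩
  | x :: l => query x fun _ => askAll l

/-- Run a list of algorithms one after the other. -/
def runAll : List (OracleAlg X Y A) → OracleAlg X Y PUnit.{1}
  | [] => output ⟨⟩
  | a :: l => bind a fun _ => runAll l

/-- All queries occurring in the decision tree. -/
noncomputable def nodes [∀ x, Fintype (Y x)] : OracleAlg X Y A → Finset X
  | output _ => ∅
  | query x next => insert x (Finset.univ.biUnion fun y => nodes (next y))

/-- All outputs occurring in the decision tree. -/
noncomputable def leaves [∀ x, Fintype (Y x)] : OracleAlg X Y A → Finset A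
  | output a => {a}
  | query _ next => Finset.univ.biUnion fun y => leaves (next y)

theorem run_congr {O O' : Oracle X Y} (a : OracleAlg X Y A) (h : ∀ x ∈ a.queries O, O x = O' x) :
    a.run O = a.run O' ∧ a.queries O = a.queries O' ∧ a.numQueries O = a.numQueries O' := by
  induction a with
  | output a => simp [run, queries, numQueries]
  | query x next ih =>
    have hx : O x = O' x := h x (by simp [queries])
    have := ih (O x) fun z hz => h z (by simp [queries, hz])
    simp only [run, queries, numQueries]
    rw [← hx]
    exact ⟨this.1, by rw [this.2.1], by rw [this.2.2]⟩

theorem card_queries_le (O : Oracle X Y) (a : OracleAlg X Y A) :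
    (a.queries O).card ≤ a.numQueries O := by
  induction a with
  | output a => simp [queries]
  | query x next ih =>
    exact (Finset.card_insert_le _ _).trans (Nat.succ_le_succ (ih _))

@[simp] theorem run_bind (O : Oracle X Y) (a : OracleAlg X Y A) (f : A → OracleAlg X Y B) :
    (a.bind f).run O = (f (a.run O)).run O := by
  induction a with
  | output a => rfl
  | query x next ih => simpa [bind, run] using ih _

@[simp] theorem queries_bind (O : Oracle X Y) (a : OracleAlg X Y A) (f : A → OracleAlg X Y B) :
    (a.bind f).queries O = a.queries O ∪ (f (a.run O)).queries O := by
  induction a with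
  | output a => simp [bind, run, queries]
  | query x next ih => simp [bind, run, queries, ih]

@[simp] theorem numQueries_bind (O : Oracle X Y) (a : OracleAlg X Y A)
    (f : A → OracleAlg X Y B) :
    (a.bind f).numQueries O = a.numQueries O + (f (a.run O)).numQueries O := by
  induction a with
  | output a => simp [bind, run, numQueries]
  | query x next ih => simp only [bind, run, numQueries, ih]; omega

/-- The oracle that answers according to `O'` on `K` and according to `O` elsewhere. -/
noncomputable def _root_.Oracle.patch (K : Set X) (O' O : Oracle X Y) : Oracle X Y :=
  fun x => if x ∈ K then O' x else O x

theorem _root_.Oracle.patch_of_mem {K : Set X} {x : X} (hx : x ∈ K) (O' O : Oracle X Y) :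
    Oracle.patch K O' O x = O' x := if_pos hx

theorem _root_.Oracle.patch_of_notMem {K : Set X} {x : X} (hx : x ∉ K) (O' O : Oracle X Y) :
    Oracle.patch K O' O x = O x := if_neg hx

@[simp] theorem run_override (K : Set X) (O' O : Oracle X Y) (a : OracleAlg X Y A) :
    (a.override K O').run O = a.run (Oracle.patch K O' O) := by
  induction a with
  | output a => rfl
  | query x next ih =>
    by_cases hx : x ∈ K <;> simp [override, run, hx, ih, Oracle.patch]

theorem queries_override (K : Set X) (O' O : Oracle X Y) (a : OracleAlg X Y A) :
    ∀ x, x ∈ (a.override K O').queries O ↔ x ∈ a.queries (Oracle.patch K O' O) ∧ x ∉ K := by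
  induction a with
  | output a => simp [override, queries]
  | query x next ih =>
    intro z
    by_cases hx : x ∈ K
    · simp only [override, hx, queries, ih, if_true, Oracle.patch_of_mem hx, Finset.mem_insert]
      constructor
      · tauto
      · rintro ⟨rfl | h, h'⟩
        · exact absurd hx h'
        · exact ⟨h, h'⟩
    · simp only [override, hx, queries, ih, if_false, Oracle.patch_of_notMem hx, Finset.mem_insert]
      constructor
      · rintro (rfl | h)
        · exact ⟨Or.inl rfl, hx⟩
        · exact ⟨Or.inr h.1, h.2⟩
      · tauto

theorem numQueries_override_le (K : Set X) (O' O : Oracle X Y) (a : OracleAlg X Y A) :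
    (a.override K O').numQueries O ≤ a.numQueries (Oracle.patch K O' O) := by
  induction a with
  | output a => simp [override, numQueries]
  | query x next ih =>
    by_cases hx : x ∈ K
    · simp only [override, hx, numQueries, if_true, Oracle.patch_of_mem hx]
      exact (ih _).trans (Nat.le_succ _)
    · simp only [override, hx, numQueries, if_false, Oracle.patch_of_notMem hx]
      exact Nat.succ_le_succ (ih _)

theorem run_record (f : Oracle X Y → OracleAlg X Y B) (O O₀ : Oracle X Y) (a : OracleAlg X Y A) :
    (a.record f O₀).run O = (f (Oracle.patch (a.queries O) O O₀)).run O ∧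
    (a.record f O₀).numQueries O =
      a.numQueries O + (f (Oracle.patch (a.queries O) O O₀)).numQueries O := by
  induction a generalizing O₀ with
  | output a =>
    have : Oracle.patch ((output a : OracleAlg X Y A).queries O) O O₀ = O₀ := by
      funext x; simp [Oracle.patch, queries]
    simp [record, this, numQueries]
  | query x next ih =>
    have key : Oracle.patch ((next (O x)).queries O) O (Function.update O₀ x (O x)) =
        Oracle.patch ((query x next).queries O) O O₀ := by
      funext z
      by_cases hz : z ∈ (next (O x)).queries O
      · simp [Oracle.patch, queries, hz]
      · by_cases hzx : z = x
        · subst hzx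
          simp only [Oracle.patch, queries, Finset.mem_coe, Finset.mem_insert, true_or, if_true]
          rw [if_neg hz]
          exact Function.update_self ..
        · simp only [Oracle.patch, queries, Finset.mem_coe, Finset.mem_insert, hz, hzx, or_self,
            if_false]
          exact Function.update_of_ne hzx ..
    have := ih (O x) (Function.update O₀ x (O x))
    rw [key] at this
    simp only [record, run, numQueries]
    exact ⟨this.1, by rw [this.2]; omega⟩

theorem queries_patch_queries (a : OracleAlg X Y A) (O O₀ : Oracle X Y) :
    a.queries (Oracle.patch (a.queries O) O O₀) = a.queries O :=
  (run_congr a fun _ hx => (Oracle.patch_of_mem (by simpa using hx) O O₀).symm).2.1.symm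

/-- The set of queries can be recovered from the recorded table by running `a` on it, so equal
tables mean equal transcripts, whatever the background `O₀`. -/
theorem patch_queries_eq_iff (a : OracleAlg X Y A) (O O' O₀ : Oracle X Y) :
    Oracle.patch (a.queries O) O O₀ = Oracle.patch (a.queries O') O' O₀ ↔
      ∀ x ∈ a.queries O, O x = O' x := by
  constructor
  · intro h x hx
    have hq : a.queries O = a.queries O' := by
      rw [← queries_patch_queries a O O₀, h, queries_patch_queries]
    have h1 := congrFun h x
    rw [Oracle.patch_of_mem (by simpa using hx), Oracle.patch_of_mem (by simpa [← hq] using hx)]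
      at h1
    exact h1
  · intro h
    rw [← (run_congr a h).2.1]
    funext x
    by_cases hx : x ∈ a.queries O
    · simp [Oracle.patch, hx, h x hx]
    · simp [Oracle.patch, hx]

theorem numQueries_truncate_le (d : A) (n : ℕ) (O : Oracle X Y) (a : OracleAlg X Y A) :
    (a.truncate d n).numQueries O ≤ n := by
  induction a generalizing n with
  | output a => simp [truncate, numQueries]
  | query x next ih =>
    cases n with
    | zero => simp [truncate, numQueries]
    | succ n => simpa [truncate, numQueries] using ih _ n

theorem run_truncate (d : A) (n : ℕ) (O : Oracle X Y) (a : OracleAlg X Y A)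
    (h : a.numQueries O ≤ n) : (a.truncate d n).run O = a.run O := by
  induction a generalizing n with
  | output a => simp [truncate, run]
  | query x next ih =>
    cases n with
    | zero => simp [numQueries] at h
    | succ n => simpa [truncate, run] using ih _ n (by simpa [numQueries] using h)

@[simp] theorem queries_askAll (O : Oracle X Y) (l : List X) :
    (askAll l).queries O = l.toFinset := by
  induction l with
  | nil => simp [askAll, queries]
  | cons x l ih => simp [askAll, queries, ih]

@[simp] theorem numQueries_askAll (O : Oracle X Y) (l : List X) :
    (askAll l).numQueries O = l.length := by
  induction l with
  | nil => simp [askAll, numQueries]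
  | cons x l ih => simp [askAll, numQueries, ih]

theorem mem_queries_runAll (O : Oracle X Y) (l : List (OracleAlg X Y A)) (x : X) :
    x ∈ (runAll l).queries O ↔ ∃ a ∈ l, x ∈ a.queries O := by
  induction l with
  | nil => simp [runAll, queries]
  | cons a l ih => simp [runAll, ih]

theorem numQueries_runAll_le (O : Oracle X Y) (l : List (OracleAlg X Y A)) (q : ℕ)
    (h : ∀ a ∈ l, a.numQueries O ≤ q) : (runAll l).numQueries O ≤ l.length * q := by
  induction l with
  | nil => simp [runAll, numQueries]
  | cons a l ih =>
    have h1 := h a (by simp)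
    have h2 := ih fun b hb => h b (by simp [hb])
    simp only [runAll, numQueries_bind, List.length_cons]
    nlinarith

theorem queries_subset_nodes [∀ x, Fintype (Y x)] (O : Oracle X Y) (a : OracleAlg X Y A) :
    a.queries O ⊆ a.nodes := by
  induction a with
  | output a => simp [queries]
  | query x next ih =>
    exact Finset.insert_subset_insert _
      ((ih _).trans (Finset.subset_biUnion_of_mem (fun y => (next y).nodes) (Finset.mem_univ _)))

theorem run_mem_leaves [∀ x, Fintype (Y x)] (O : Oracle X Y) (a : OracleAlg X Y A) :
    a.run O ∈ a.leaves := by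
  induction a with
  | output a => simp [run, leaves]
  | query x next ih => exact Finset.mem_biUnion.2 ⟨O x, Finset.mem_univ _, ih _⟩

end OracleAlg

/-! ### The set-pair inequality and bounds for the middle binomial coefficient. -/

section Combinatorics

open scoped Classical in
/-- The Bollobás set-pair inequality. -/
theorem sum_inv_choose_le_one_of_cross_intersecting {ι α : Type*} (U : Finset α) (I : Finset ι)
    (A B : ι → Finset α) (hA : ∀ i ∈ I, A i ⊆ U) (hB : ∀ i ∈ I, B i ⊆ U)
    (hd : ∀ i ∈ I, Disjoint (A i) (B i))
    (hc : ∀ i ∈ I, ∀ j ∈ I, j ≠ i → ¬ Disjoint (A j) (B i)) :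
    ∑ i ∈ I, (1 / (((A i).card + (B i).card).choose (A i).card : ℕ) : ℚ) ≤ 1 := by
  induction hn : U.card generalizing U I B with
  | zero =>
    have hU : U = ∅ := Finset.card_eq_zero.1 hn
    subst hU
    have hB0 : ∀ i ∈ I, B i = ∅ := fun i hi => Finset.subset_empty.1 (hB i hi)
    have hA0 : ∀ i ∈ I, A i = ∅ := fun i hi => Finset.subset_empty.1 (hA i hi)
    have hI : I.card ≤ 1 := Finset.card_le_one.2 fun i hi j hj => by
      by_contra hij
      exact hc i hi j hj (Ne.symm hij) (by simp [hB0 i hi])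
    rw [Finset.sum_congr rfl (g := fun _ => (1 : ℚ)) fun i hi => by simp [hA0 i hi, hB0 i hi]]
    simpa using hI
  | succ n ih =>
    -- No set meets an empty `B i`, so such an `i` is the only index.
    by_cases hE : ∃ i ∈ I, B i = ∅
    · obtain ⟨i, hi, hBi⟩ := hE
      have hI : I = {i} := Finset.eq_singleton_iff_unique_mem.2 ⟨hi, fun j hj => by
        by_contra hij
        exact hc i hi j hj hij (by simp [hBi])⟩
      simp [hI, hBi]
    · push Not at hE
      -- Keep the pairs with `x ∉ A i` and delete `x` from their `B i`: a point of `A j ∩ B i`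
      -- differs from `x`, so the family stays cross-intersecting on a smaller ground set. The claim
      -- follows by summing over all `x`.
      have hx : ∀ x ∈ U, ∑ i ∈ I with x ∉ A i,
          (1 / (((A i).card + ((B i).erase x).card).choose (A i).card : ℕ) : ℚ) ≤ 1 := by
        intro x hx
        refine ih (U.erase x) (I.filter fun i => x ∉ A i) (fun i => (B i).erase x) ?_ ?_ ?_ ?_ ?_
        · intro i hi
          rw [Finset.mem_filter] at hi
          exact Finset.subset_erase.2 ⟨hA i hi.1, hi.2⟩
        · intro i hi
          exact Finset.erase_subset_erase _ (hB i (Finset.mem_filter.1 hi).1)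
        · intro i hi
          exact (hd i (Finset.mem_filter.1 hi).1).mono_right (Finset.erase_subset _ _)
        · intro i hi j hj hij hdis
          rw [Finset.mem_filter] at hi hj
          obtain ⟨y, hy, hy'⟩ := Finset.not_disjoint_iff.1 (hc i hi.1 j hj.1 hij)
          refine Finset.disjoint_left.1 hdis hy (Finset.mem_erase.2 ⟨?_, hy'⟩)
          rintro rfl
          exact hj.2 hy
        · rw [Finset.card_erase_of_mem hx, hn]; rfl
      have hsum := Finset.sum_le_sum hx
      simp only [Finset.sum_filter] at hsum
      rw [Finset.sum_comm] at hsum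
      -- With a = |A i| and c = |B i|, there are c points that shrink `B i` and n + 1 - a - c that
      -- change nothing. The identity c / C(a+c-1, a) = (a+c) / C(a+c, a) makes the total (n + 1) /
      -- C(a+c, a).
      have hterm : ∀ i ∈ I, ∑ x ∈ U, (if x ∉ A i then
          (1 / (((A i).card + ((B i).erase x).card).choose (A i).card : ℕ) : ℚ) else 0) =
          (n + 1) * (1 / (((A i).card + (B i).card).choose (A i).card : ℕ) : ℚ) := by
        intro i hi
        have hbpos : 0 < (B i).card := Finset.card_pos.2 (hE i hi)
        obtain ⟨b, hb⟩ := Nat.exists_eq_succ_of_ne_zero hbpos.ne'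
        rw [← Finset.sum_filter]
        have hsplit : U.filter (fun x => x ∉ A i) = B i ∪ (U \ (A i ∪ B i)) := by
          ext x
          have h1 : x ∈ B i → x ∈ U := fun h => hB i hi h
          have h2 : x ∈ A i → x ∉ B i := fun h => Finset.disjoint_left.1 (hd i hi) h
          simp only [Finset.mem_filter, Finset.mem_union, Finset.mem_sdiff]
          tauto
        have hdis : Disjoint (B i) (U \ (A i ∪ B i)) :=
          Finset.disjoint_left.2 fun x hx hx' => by simp_all
        rw [hsplit, Finset.sum_union hdis,
          Finset.sum_congr rfl (g := fun _ =>
            (1 / (((A i).card + b).choose (A i).card : ℕ) : ℚ)) (s₁ := B i)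
            (fun x hx => by rw [Finset.card_erase_of_mem hx, hb]; simp),
          Finset.sum_congr rfl (g := fun _ =>
            (1 / (((A i).card + (B i).card).choose (A i).card : ℕ) : ℚ))
            (s₁ := U \ (A i ∪ B i))
            (fun x hx => by
              rw [Finset.erase_eq_of_notMem]
              simp only [Finset.mem_sdiff, Finset.mem_union] at hx; tauto)]
        have hcard : (U \ (A i ∪ B i)).card + ((A i).card + (B i).card) = n + 1 := by
          rw [← Finset.card_union_of_disjoint (hd i hi), Finset.card_sdiff_add_card,
            Finset.union_eq_left.2 (Finset.union_subset (hA i hi) (hB i hi)), hn]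
        have hcardQ : ((U \ (A i ∪ B i)).card : ℚ) = n + 1 - ((A i).card + (b + 1)) := by
          rw [hb] at hcard
          have : (((U \ (A i ∪ B i)).card : ℚ) + ((A i).card + (b + 1))) = n + 1 := by
            exact_mod_cast hcard
          linarith
        have hch := Nat.add_one_mul_choose_eq ((A i).card + b) b
        rw [Finset.sum_const, Finset.sum_const, nsmul_eq_mul, nsmul_eq_mul, hcardQ, hb]
        have e1 : ((A i).card + b).choose (A i).card = ((A i).card + b).choose b :=
          Nat.choose_symm_add
        have e2 : ((A i).card + b.succ).choose (A i).card = ((A i).card + b + 1).choose (b + 1) :=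
          Nat.choose_symm_add
        rw [e1, e2]
        have p1 : (0 : ℚ) < (((A i).card + b).choose b : ℕ) := by
          exact_mod_cast Nat.choose_pos (Nat.le_add_left _ _)
        have p2 : (0 : ℚ) < (((A i).card + b + 1).choose (b + 1) : ℕ) := by
          exact_mod_cast Nat.choose_pos (by omega)
        have hchQ : (((A i).card : ℚ) + b + 1) * (((A i).card + b).choose b : ℕ) =
            (((A i).card + b + 1).choose (b + 1) : ℕ) * (b + 1) := by exact_mod_cast hch
        push_cast
        field_simp
        linear_combination -hchQ
      rw [Finset.sum_congr rfl hterm, ← Finset.mul_sum] at hsum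
      simp only [Finset.sum_const, hn, nsmul_eq_mul] at hsum
      push_cast at hsum
      have : (0 : ℚ) < n + 1 := by positivity
      nlinarith

theorem choose_le_choose_half {n q : ℕ} (h : n ≤ q) (k : ℕ) : n.choose k ≤ q.choose (q / 2) :=
  (Nat.choose_le_choose k h).trans (Nat.choose_le_middle k q)

/-- Set pairs with bounded total size: a family with `A i ∩ B i = ∅` and `A j ∩ B i ≠ ∅` for
`i ≠ j` has at most as many members as the middle binomial coefficient. -/
theorem card_le_choose_half_of_cross_intersecting {ι α : Type*} (q : ℕ) (I : Finset ι)
    (A B : ι → Finset α) (hd : ∀ i ∈ I, Disjoint (A i) (B i))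
    (hc : ∀ i ∈ I, ∀ j ∈ I, j ≠ i → ¬ Disjoint (A j) (B i))
    (hq : ∀ i ∈ I, (A i).card + (B i).card ≤ q) : I.card ≤ q.choose (q / 2) := by
  classical
  have h := sum_inv_choose_le_one_of_cross_intersecting (I.biUnion A ∪ I.biUnion B) I A B
    (fun i hi => (Finset.subset_biUnion_of_mem A hi).trans Finset.subset_union_left)
    (fun i hi => (Finset.subset_biUnion_of_mem B hi).trans Finset.subset_union_right) hd hc
  have hN : (0 : ℚ) < (q.choose (q / 2) : ℕ) := by
    exact_mod_cast Nat.choose_pos (Nat.div_le_self _ _)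
  have h2 : ∑ _i ∈ I, (1 / (q.choose (q / 2) : ℕ) : ℚ) ≤ 1 := by
    refine (Finset.sum_le_sum fun i hi => ?_).trans h
    refine one_div_le_one_div_of_le ?_ ?_
    · exact_mod_cast Nat.choose_pos (Nat.le_add_right _ _)
    · exact_mod_cast choose_le_choose_half (hq i hi) _
  rw [Finset.sum_const, nsmul_eq_mul, mul_one_div, div_le_one hN] at h2
  exact_mod_cast h2

/-- Passing from m to m + 1 multiplies the left side by 4(2m+1)(2m+3)/(m+1)², which is less than 16.
-/
theorem centralBinom_sq_mul_le (m : ℕ) : m.centralBinom ^ 2 * (2 * m + 1) ≤ 16 ^ m := by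
  induction m with
  | zero => simp
  | succ m ih =>
    have h := Nat.succ_mul_centralBinom_succ m
    have h2 : (m + 1) ^ 2 * ((m + 1).centralBinom ^ 2 * (2 * (m + 1) + 1)) =
        4 * (2 * m + 1) * (2 * m + 3) * (m.centralBinom ^ 2 * (2 * m + 1)) := by
      calc _ = ((m + 1) * (m + 1).centralBinom) ^ 2 * (2 * m + 3) := by ring
        _ = _ := by rw [h]; ring
    refine le_of_mul_le_mul_left ?_ (pow_pos (Nat.succ_pos m) 2)
    calc (m + 1) ^ 2 * ((m + 1).centralBinom ^ 2 * (2 * (m + 1) + 1))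
        = 4 * (2 * m + 1) * (2 * m + 3) * (m.centralBinom ^ 2 * (2 * m + 1)) := h2
      _ ≤ 16 * (m + 1) ^ 2 * 16 ^ m := Nat.mul_le_mul (by nlinarith) ih
      _ = (m + 1) ^ 2 * 16 ^ (m + 1) := by ring

theorem choose_half_sq_mul_le (q : ℕ) : q.choose (q / 2) ^ 2 * q ≤ 4 ^ q := by
  rcases Nat.even_or_odd' q with ⟨m, rfl | rfl⟩
  · have h := centralBinom_sq_mul_le m
    rw [Nat.centralBinom_eq_two_mul_choose] at h
    rw [Nat.mul_div_cancel_left _ two_pos, pow_mul]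
    exact (Nat.mul_le_mul_left _ (Nat.le_succ _)).trans h
  · have h := centralBinom_sq_mul_le (m + 1)
    have e : (m + 1).centralBinom = 2 * (2 * m + 1).choose m := by
      rw [Nat.centralBinom_eq_two_mul_choose, show 2 * (m + 1) = (2 * m + 1) + 1 by ring,
        Nat.choose_succ_succ, Nat.choose_symm_half]
      ring
    rw [e] at h
    rw [show (2 * m + 1) / 2 = m by omega]
    have e2 : 4 ^ (2 * m + 1) * 4 = 16 ^ (m + 1) := by
      rw [← pow_succ, show 2 * m + 1 + 1 = 2 * (m + 1) by ring, pow_mul]; norm_num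
    nlinarith [Nat.zero_le ((2 * m + 1).choose m ^ 2)]

theorem choose_half_mul_sqrt_le (q : ℕ) :
    (q.choose (q / 2) : ℝ) * Real.sqrt q ≤ 2 ^ q := by
  have h : ((q.choose (q / 2) : ℝ)) ^ 2 * q ≤ 4 ^ q := by exact_mod_cast choose_half_sq_mul_le q
  refine le_of_sq_le_sq ?_ (by positivity)
  rw [mul_pow, Real.sq_sqrt (Nat.cast_nonneg q), ← pow_mul, mul_comm q 2, pow_mul]
  norm_num
  exact h

end Combinatorics

/-! ### Views, secret queries and the attack with a hypothetical execution. -/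

namespace OracleSigScheme

open scoped Classical
open OracleAlg

variable {X : Type u} {Y : X → Type v}
  {M : Type w₁} {SK : Type w₂} {VK : Type w₃} {Sig : Type w₄}

/-- Generate the keys and sign `α`; the output is what the forger gets to see. -/
def viewAlg (S : OracleSigScheme X Y M SK VK Sig) (α : M) (g : OracleAlg X Y (SK × VK)) :
    OracleAlg X Y (VK × Sig) :=
  g.bind fun k => (S.sign k.1 α).bind fun σ => output (k.2, σ)

/-- Sign `j` and verify the signature. -/
def honest (S : OracleSigScheme X Y M SK VK Sig) (k : SK × VK) (j : M) : OracleAlg X Y Bool :=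
  (S.sign k.1 j).bind fun σ => S.ver k.2 j σ

/-- The verification key and the signature of `α`, for given coins and oracle. -/
def view (S : OracleSigScheme X Y M SK VK Sig) (α : M)
    (R : OracleAlg X Y (SK × VK) × Oracle X Y) : VK × Sig :=
  (S.viewAlg α R.1).run R.2

/-- The queries asked by key generation and by signing `α`. -/
noncomputable def secret (S : OracleSigScheme X Y M SK VK Sig) (α : M)
    (R : OracleAlg X Y (SK × VK) × Oracle X Y) : Finset X :=
  (S.viewAlg α R.1).queries R.2

/-- The queries asked when the honest signature of `α` is verified. -/
noncomputable def verSet (S : OracleSigScheme X Y M SK VK Sig) (α : M)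
    (R : OracleAlg X Y (SK × VK) × Oracle X Y) : Finset X :=
  (S.ver (S.view α R).1 α (S.view α R).2).queries R.2

/-- The queries asked when all messages in `MS` are signed and verified. -/
noncomputable def execSet (S : OracleSigScheme X Y M SK VK Sig) (MS : Finset M)
    (R : OracleAlg X Y (SK × VK) × Oracle X Y) : Finset X :=
  MS.biUnion fun j => (S.honest (R.1.run R.2) j).queries R.2

/-- `R` and `R'` are indistinguishable for a forger that has seen the signature of `α`, has
verified it, and has asked the queries in `L`. -/
def Rel (S : OracleSigScheme X Y M SK VK Sig) (α : M) (L : Finset X)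
    (R R' : OracleAlg X Y (SK × VK) × Oracle X Y) : Prop :=
  S.view α R = S.view α R' ∧ ∀ x ∈ S.verSet α R ∪ L, R.2 x = R'.2 x

/-- No other message is verified without asking a secret query unknown to the forger. -/
def Blocked (S : OracleSigScheme X Y M SK VK Sig) (MS : Finset M) (α : M)
    (R : OracleAlg X Y (SK × VK) × Oracle X Y) : Prop :=
  ∀ j ∈ MS, j ≠ α → ¬ S.verSet j R ∩ S.secret α R ⊆ S.verSet α R

variable (S : OracleSigScheme X Y M SK VK Sig)

theorem view_eq (α : M) (R : OracleAlg X Y (SK × VK) × Oracle X Y) :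
    S.view α R = ((R.1.run R.2).2, (S.sign (R.1.run R.2).1 α).run R.2) := by
  simp [view, viewAlg, run]

theorem secret_eq (α : M) (R : OracleAlg X Y (SK × VK) × Oracle X Y) :
    S.secret α R = R.1.queries R.2 ∪ (S.sign (R.1.run R.2).1 α).queries R.2 := by
  simp [secret, viewAlg, queries]

theorem honest_queries_eq (j : M) (R : OracleAlg X Y (SK × VK) × Oracle X Y) :
    (S.honest (R.1.run R.2) j).queries R.2 =
      (S.sign (R.1.run R.2).1 j).queries R.2 ∪ S.verSet j R := by
  simp [honest, verSet, view_eq]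

theorem view_secret_congr (α : M) (g : OracleAlg X Y (SK × VK)) {O O' : Oracle X Y}
    (h : ∀ x ∈ S.secret α (g, O), O x = O' x) :
    S.view α (g, O') = S.view α (g, O) ∧ S.secret α (g, O') = S.secret α (g, O) := by
  have := run_congr (S.viewAlg α g) h
  exact ⟨this.1.symm, this.2.1.symm⟩

theorem keys_congr (α : M) (g : OracleAlg X Y (SK × VK)) {O O' : Oracle X Y}
    (h : ∀ x ∈ S.secret α (g, O), O x = O' x) : g.run O' = g.run O := by
  refine (run_congr g fun x hx => h x ?_).1.symm
  rw [secret_eq]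
  exact Finset.mem_union_left _ hx

theorem verSet_congr (α : M) {R R' : OracleAlg X Y (SK × VK) × Oracle X Y}
    (hz : S.view α R = S.view α R') (h : ∀ x ∈ S.verSet α R, R.2 x = R'.2 x) :
    S.verSet α R' = S.verSet α R := by
  have := run_congr _ h
  rw [verSet, ← hz]
  exact this.2.1.symm

/-- An execution is determined by the answers to its queries. -/
theorem honest_congr (j : M) (g : OracleAlg X Y (SK × VK)) {O O' : Oracle X Y}
    (hk : g.run O' = g.run O)
    (h : ∀ x ∈ (S.honest (g.run O) j).queries O, O x = O' x) :
    S.view j (g, O') = S.view j (g, O) ∧ S.verSet j (g, O') = S.verSet j (g, O) := by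
  have e := S.honest_queries_eq j (g, O)
  have h1 : S.view j (g, O) = S.view j (g, O') := by
    rw [view_eq, view_eq]
    simp only [hk]
    rw [(run_congr (S.sign (g.run O).1 j) fun x hx => h x (by
      rw [e]; exact Finset.mem_union_left _ hx)).1]
  exact ⟨h1.symm, S.verSet_congr j h1 fun x hx => h x (by
    rw [e]; exact Finset.mem_union_right _ hx)⟩

namespace Rel

variable {S} {α : M} {L : Finset X} {R R' R'' : OracleAlg X Y (SK × VK) × Oracle X Y}

theorem verSet_eq (h : S.Rel α L R R') : S.verSet α R' = S.verSet α R :=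
  S.verSet_congr α h.1 fun x hx => h.2 x (Finset.mem_union_left _ hx)

theorem refl : S.Rel α L R R := ⟨rfl, fun _ _ => rfl⟩

theorem symm (h : S.Rel α L R R') : S.Rel α L R' R :=
  ⟨h.1.symm, fun x hx => (h.2 x (by rwa [← h.verSet_eq])).symm⟩

theorem trans (h : S.Rel α L R R') (h' : S.Rel α L R' R'') : S.Rel α L R R'' :=
  ⟨h.1.trans h'.1, fun x hx => (h.2 x hx).trans (h'.2 x (by rwa [h.verSet_eq]))⟩

end Rel

/-- The forgery succeeds; moreover its verification asks only queries in `X₀`. -/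
def Forges (α : M) (X₀ : Finset X) (a : OracleAlg X Y (M × Sig))
    (R : OracleAlg X Y (SK × VK) × Oracle X Y) : Prop :=
  (a.run R.2).1 ≠ α ∧ (S.ver (R.1.run R.2).2 (a.run R.2).1 (a.run R.2).2).run R.2 = true ∧
    (S.ver (R.1.run R.2).2 (a.run R.2).1 (a.run R.2).2).queries R.2 ⊆ X₀

/-- Execute the scheme on all messages with the hypothetical coins and secret answers of `R'`, and
output a message whose verification does not touch unknown secret answers. -/
noncomputable def attack (MS : Finset M) (α : M) (L : Finset X) (d : M × Sig)
    (R' : OracleAlg X Y (SK × VK) × Oracle X Y) : OracleAlg X Y (M × Sig) :=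
  record (fun O => output
      (if h : ∃ j ∈ MS, j ≠ α ∧ S.verSet j (R'.1, Oracle.patch (S.secret α R') R'.2 O) ∩
          S.secret α R' ⊆ S.verSet α R' ∪ L then
        (h.choose, (S.view h.choose (R'.1, Oracle.patch (S.secret α R') R'.2 O)).2)
      else d))
    (runAll (MS.toList.map fun j =>
      (S.honest (R'.1.run R'.2) j).override (S.secret α R') R'.2)) R'.2

theorem keys_patch_secret (α : M) (R' : OracleAlg X Y (SK × VK) × Oracle X Y) (O : Oracle X Y) :
    R'.1.run (Oracle.patch (S.secret α R') R'.2 O) = R'.1.run R'.2 :=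
  S.keys_congr α R'.1 fun _ hx => (Oracle.patch_of_mem (by simpa using hx) _ _).symm

theorem run_attack (MS : Finset M) (α : M) (L : Finset X) (d : M × Sig)
    (R' : OracleAlg X Y (SK × VK) × Oracle X Y) (O : Oracle X Y)
    (hex : ∃ j ∈ MS, j ≠ α ∧ S.verSet j (R'.1, Oracle.patch (S.secret α R') R'.2 O) ∩
          S.secret α R' ⊆ S.verSet α R' ∪ L) :
    ∃ j ∈ MS, j ≠ α ∧ S.verSet j (R'.1, Oracle.patch (S.secret α R') R'.2 O) ∩
          S.secret α R' ⊆ S.verSet α R' ∪ L ∧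
      (S.attack MS α L d R').run O =
        (j, (S.view j (R'.1, Oracle.patch (S.secret α R') R'.2 O)).2) := by
  rw [attack, (run_record _ _ _ _).1]
  set D := (runAll (MS.toList.map fun j =>
      (S.honest (R'.1.run R'.2) j).override (S.secret α R') R'.2)).queries O with hD
  set O₁ := Oracle.patch (D : Set X) O R'.2
  -- The forger evaluates its criterion on the recorded table `O₁`. This changes nothing, since all
  -- queries of the honest executions outside the secret set were recorded.
  have key : ∀ j ∈ MS,
      S.view j (R'.1, Oracle.patch (S.secret α R') R'.2 O₁) =
        S.view j (R'.1, Oracle.patch (S.secret α R') R'.2 O) ∧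
      S.verSet j (R'.1, Oracle.patch (S.secret α R') R'.2 O₁) =
        S.verSet j (R'.1, Oracle.patch (S.secret α R') R'.2 O) := by
    intro j hj
    refine S.honest_congr j R'.1 (by rw [keys_patch_secret, keys_patch_secret]) fun x hx => ?_
    rw [keys_patch_secret] at hx
    by_cases hxs : x ∈ (S.secret α R' : Set X)
    · rw [Oracle.patch_of_mem hxs, Oracle.patch_of_mem hxs]
    · rw [Oracle.patch_of_notMem hxs, Oracle.patch_of_notMem hxs]
      refine (Oracle.patch_of_mem ?_ _ _).symm
      rw [Finset.mem_coe, hD, mem_queries_runAll]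
      refine ⟨_, List.mem_map_of_mem (Finset.mem_toList.2 hj), ?_⟩
      rw [queries_override]
      exact ⟨hx, hxs⟩
  have hex' : ∃ j ∈ MS, j ≠ α ∧ S.verSet j (R'.1, Oracle.patch (S.secret α R') R'.2 O₁) ∩
          S.secret α R' ⊆ S.verSet α R' ∪ L := by
    obtain ⟨j, hj, hja, h⟩ := hex
    exact ⟨j, hj, hja, by rwa [(key j hj).2]⟩
  obtain ⟨h1, h2, h3⟩ := hex'.choose_spec
  refine ⟨hex'.choose, h1, h2, ?_, ?_⟩
  · rwa [← (key _ h1).2]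
  · rw [dif_pos hex']
    simp only [run]
    rw [(key _ h1).1]

theorem numQueries_attack_le (MS : Finset M) (α : M) (L : Finset X) (d : M × Sig)
    (R' : OracleAlg X Y (SK × VK) × Oracle X Y) (O : Oracle X Y) (q : ℕ)
    (hq : ∀ j ∈ MS, (S.honest (R'.1.run R'.2) j).numQueries
      (Oracle.patch (S.secret α R') R'.2 O) ≤ q) :
    (S.attack MS α L d R').numQueries O ≤ MS.card * q := by
  rw [attack, (run_record _ _ _ _).2]
  simp only [numQueries, add_zero]
  refine (numQueries_runAll_le O _ q ?_).trans (by simp)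
  intro a ha
  obtain ⟨j, hj, rfl⟩ := List.mem_map.1 ha
  exact (numQueries_override_le _ _ _ _).trans (hq j (Finset.mem_toList.1 hj))

/-! ### The exchange of two indistinguishable oracles. -/

/-- The positions outside which two oracles are exchanged. -/
noncomputable def swapSet (α : M) (L : Finset X)
    (R R' : OracleAlg X Y (SK × VK) × Oracle X Y) : Finset X :=
  S.verSet α R ∪ L ∪ S.secret α R ∪ S.secret α R'

/-- Exchange two oracles outside the known queries and the secret queries. -/
noncomputable def swap (α : M) (L : Finset X)
    (P : (OracleAlg X Y (SK × VK) × Oracle X Y) × (OracleAlg X Y (SK × VK) × Oracle X Y)) :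
    (OracleAlg X Y (SK × VK) × Oracle X Y) × (OracleAlg X Y (SK × VK) × Oracle X Y) :=
  ((P.1.1, Oracle.patch (S.swapSet α L P.1 P.2) P.1.2 P.2.2),
    (P.2.1, Oracle.patch (S.swapSet α L P.1 P.2) P.2.2 P.1.2))

section Swap

variable {S} {α : M} {L : Finset X} {R R' : OracleAlg X Y (SK × VK) × Oracle X Y}

/-- View and secret set depend only on the answers at secret positions, which lie in `K` and are not
changed. -/
theorem patch_swapSet_fst (K : Finset X) (O : Oracle X Y) (hK : S.secret α R ⊆ K)
    (hV : S.verSet α R ∪ L ⊆ K) :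
    S.secret α (R.1, Oracle.patch K R.2 O) = S.secret α R ∧
      S.Rel α L R (R.1, Oracle.patch K R.2 O) := by
  have h := S.view_secret_congr α R.1 (O := R.2) (O' := Oracle.patch K R.2 O)
    fun x hx => (Oracle.patch_of_mem (by simpa using hK hx) _ _).symm
  exact ⟨h.2, h.1.symm, fun x hx => (Oracle.patch_of_mem (by simpa using hV hx) _ _).symm⟩

theorem swap_fst (R R' : OracleAlg X Y (SK × VK) × Oracle X Y) :
    S.secret α (S.swap α L (R, R')).1 = S.secret α R ∧
      S.Rel α L R (S.swap α L (R, R')).1 :=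
  patch_swapSet_fst _ _ (by intro x hx; simp [swapSet, hx])
    (by intro x hx; simp only [swapSet, Finset.mem_union] at hx ⊢; tauto)

theorem swap_snd (h : S.Rel α L R R') :
    S.secret α (S.swap α L (R, R')).2 = S.secret α R' ∧
      S.Rel α L R' (S.swap α L (R, R')).2 :=
  patch_swapSet_fst _ _ (by intro x hx; simp [swapSet, hx])
    (by intro x hx; rw [h.verSet_eq] at hx; simp only [swapSet, Finset.mem_union] at hx ⊢; tauto)

/-- Neither the secret sets nor the known positions change under the exchange, so the second
exchange uses the same `swapSet` and undoes the first. -/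
theorem swap_swap (h : S.Rel α L R R') : S.swap α L (S.swap α L (R, R')) = (R, R') := by
  obtain ⟨h1, h2⟩ := swap_fst (S := S) (α := α) (L := L) R R'
  obtain ⟨h3, h4⟩ := swap_snd h
  have hK : S.swapSet α L (S.swap α L (R, R')).1 (S.swap α L (R, R')).2 =
      S.swapSet α L R R' := by
    rw [swapSet, h1, h3, h2.verSet_eq, ← swapSet]
  rw [swap, hK]
  have e : ∀ (K : Set X) (O O' : Oracle X Y),
      Oracle.patch K (Oracle.patch K O O') (Oracle.patch K O' O) = O := by
    intro K O O'
    funext x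
    by_cases hx : x ∈ K <;> simp [Oracle.patch, hx]
  simp only [swap, e]

end Swap

/-- If after the exchange the hypothetical execution avoids the secret queries, then the attack
succeeds. -/
theorem forges_attack {MS : Finset M} {α : M} {L X₀ : Finset X} {d : M × Sig}
    {R R' : OracleAlg X Y (SK × VK) × Oracle X Y} (h : S.Rel α L R R')
    (hc : ∀ j ∈ MS, (S.ver (R'.1.run (Oracle.patch (S.secret α R') R'.2 R.2)).2 j
      (S.view j (R'.1, Oracle.patch (S.secret α R') R'.2 R.2)).2).run
        (Oracle.patch (S.secret α R') R'.2 R.2) = true)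
    (hX : ∀ j ∈ MS, S.verSet j (R'.1, Oracle.patch (S.secret α R') R'.2 R.2) ⊆ X₀)
    (h1 : S.execSet MS (S.swap α L (R, R')).2 ∩ S.secret α (S.swap α L (R, R')).1 ⊆
      S.verSet α (S.swap α L (R, R')).1 ∪ L)
    (h2 : ¬ S.Blocked MS α (S.swap α L (R, R')).2) :
    S.Forges α X₀ (S.attack MS α L d R') R := by
  obtain ⟨e1, r1⟩ := swap_fst (S := S) (α := α) (L := L) R R'
  obtain ⟨e2, r2⟩ := swap_snd h
  rw [e1, r1.verSet_eq] at h1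
  set O' := Oracle.patch (S.secret α R') R'.2 R.2 with hO'
  set O₁ := (S.swap α L (R, R')).2.2 with hO₁
  have hsw : (S.swap α L (R, R')).2 = (R'.1, O₁) := rfl
  rw [hsw] at h1 h2 e2 r2
  have hkey₁ : R'.1.run O₁ = R'.1.run R'.2 := by
    refine S.keys_congr α R'.1 fun x hx => ?_
    refine (Oracle.patch_of_mem ?_ _ _).symm
    have : x ∈ S.secret α R' := hx
    simp [swapSet, this]
  have hkey' : R'.1.run O' = R'.1.run R'.2 := S.keys_patch_secret α R' R.2
  -- `O₁` is the exchanged oracle, `O'` the one the forger simulates. They can differ only at secret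
  -- queries of `R` that are neither known nor secret for `R'`, and `h1` says that the execution
  -- avoids these.
  have hagree : ∀ x ∈ S.execSet MS (R'.1, O₁), O₁ x = O' x := by
    intro x hx
    by_cases hQ' : x ∈ S.secret α R'
    · rw [hO', Oracle.patch_of_mem (by simpa using hQ')]
      exact Oracle.patch_of_mem (by simp [swapSet, hQ']) _ _
    · rw [hO', Oracle.patch_of_notMem (by simpa using hQ')]
      by_cases hV : x ∈ S.verSet α R ∪ L
      · refine (Oracle.patch_of_mem ?_ _ _).trans (h.2 x hV).symm
        simp only [swapSet, Finset.mem_coe, Finset.mem_union] at hV ⊢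
        tauto
      · have hQ : x ∉ S.secret α R := fun hQ => hV (h1 (Finset.mem_inter.2 ⟨hx, hQ⟩))
        refine Oracle.patch_of_notMem ?_ _ _
        simp only [swapSet, Finset.mem_coe, Finset.mem_union] at hV ⊢
        tauto
  have hsame : ∀ j ∈ MS, S.verSet j (R'.1, O') = S.verSet j (R'.1, O₁) := fun j hj =>
    (S.honest_congr j R'.1 (hkey'.trans hkey₁.symm) fun x hx =>
      hagree x (Finset.mem_biUnion.2 ⟨j, hj, hx⟩)).2
  have hex : ∃ j ∈ MS, j ≠ α ∧ S.verSet j (R'.1, O') ∩ S.secret α R' ⊆ S.verSet α R' ∪ L := by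
    simp only [Blocked, not_forall, not_not] at h2
    obtain ⟨j, hj, hja, hsub⟩ := h2
    rw [e2, r2.verSet_eq] at hsub
    exact ⟨j, hj, hja, by rw [hsame j hj]; exact hsub.trans Finset.subset_union_left⟩
  obtain ⟨j, hj, hja, hsub, hrun⟩ := S.run_attack MS α L d R' R.2 hex
  have hvk : (R.1.run R.2).2 = (R'.1.run O').2 := by
    have := congrArg Prod.fst h.1
    rw [view_eq, view_eq] at this
    rw [hkey']; exact this
  -- `O'` deviates from the real oracle only on the secret set of `R'`. By `hsub` the verification
  -- of `j` meets that set only in known positions, where the two oracles agree.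
  have hcongr := run_congr (O := O') (O' := R.2)
    (S.ver (R'.1.run O').2 j (S.view j (R'.1, O')).2) (fun x hx => by
      have hx' : x ∈ S.verSet j (R'.1, O') := by
        rw [verSet, view_eq] at *
        exact hx
      by_cases hQ' : x ∈ S.secret α R'
      · have hV := hsub (Finset.mem_inter.2 ⟨hx', hQ'⟩)
        rw [h.verSet_eq] at hV
        rw [hO', Oracle.patch_of_mem (by simpa using hQ'), h.2 x hV]
      · rw [hO', Oracle.patch_of_notMem (by simpa using hQ')])
  refine ⟨by rw [hrun]; exact hja, ?_, ?_⟩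
  · rw [hrun, hvk, ← hcongr.1]
    exact hc j hj
  · rw [hrun, hvk, ← hcongr.2.1]
    refine (Eq.subset ?_).trans (hX j hj)
    rw [verSet, view_eq]

end OracleSigScheme

/-! ### Finite models: averaging over executions and the rounds of the forger. -/

namespace OracleSigScheme

open scoped Classical
open OracleAlg

variable {X : Type u} {Y : X → Type v}
  {M : Type w₁} {SK : Type w₂} {VK : Type w₃} {Sig : Type w₄}

/-- The indicator of the event that the forgery fails. -/
noncomputable def fail (S : OracleSigScheme X Y M SK VK Sig) (α : M) (X₀ : Finset X)
    (a : OracleAlg X Y (M × Sig)) (R : OracleAlg X Y (SK × VK) × Oracle X Y) : ℝ :=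
  if S.Forges α X₀ a R then 0 else 1

/-- The indicator of `Blocked`. -/
noncomputable def blockedInd (S : OracleSigScheme X Y M SK VK Sig) (MS : Finset M) (α : M)
    (R : OracleAlg X Y (SK × VK) × Oracle X Y) : ℝ :=
  if S.Blocked MS α R then 1 else 0

/-- The number of secret queries that the forger does not know. -/
noncomputable def unknown (S : OracleSigScheme X Y M SK VK Sig) (α : M) (L : Finset X)
    (R : OracleAlg X Y (SK × VK) × Oracle X Y) : ℝ :=
  ((S.secret α R \ (S.verSet α R ∪ L)).card : ℝ)

/-- The indicator of the event that the execution `R'` asks an unknown secret query of `R`. -/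
noncomputable def hit (S : OracleSigScheme X Y M SK VK Sig) (MS : Finset M) (α : M) (L : Finset X)
    (R R' : OracleAlg X Y (SK × VK) × Oracle X Y) : ℝ :=
  if S.execSet MS R' ∩ S.secret α R ⊆ S.verSet α R ∪ L then 0 else 1

variable (S : OracleSigScheme X Y M SK VK Sig)

theorem fail_congr {α : M} {X₀ : Finset X} {a a' : OracleAlg X Y (M × Sig)}
    {R : OracleAlg X Y (SK × VK) × Oracle X Y} (h : a.run R.2 = a'.run R.2) :
    S.fail α X₀ a R = S.fail α X₀ a' R := by
  have : S.Forges α X₀ a R ↔ S.Forges α X₀ a' R := by simp only [Forges, h]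
  simp only [fail, this]

/-- A hit means that `R'` asks some unknown secret query of `R`; learning the queries of `R'`
removes at least this one. -/
theorem unknown_add_hit_le (MS : Finset M) (α : M) (L : Finset X)
    (R R' : OracleAlg X Y (SK × VK) × Oracle X Y) :
    S.unknown α (L ∪ S.execSet MS R') R + S.hit MS α L R R' ≤ S.unknown α L R := by
  have hsub : S.secret α R \ (S.verSet α R ∪ (L ∪ S.execSet MS R')) ⊆
      S.secret α R \ (S.verSet α R ∪ L) := by
    refine Finset.sdiff_subset_sdiff subset_rfl fun x hx => ?_
    simp only [Finset.mem_union] at hx ⊢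
    tauto
  unfold unknown hit
  split_ifs with h
  · simpa using Finset.card_le_card hsub
  · obtain ⟨x, hx, hx'⟩ := Finset.not_subset.1 h
    rw [Finset.mem_inter] at hx
    have : S.secret α R \ (S.verSet α R ∪ (L ∪ S.execSet MS R')) ⊂
        S.secret α R \ (S.verSet α R ∪ L) := by
      refine Finset.ssubset_iff_of_subset hsub |>.2 ⟨x, ?_, ?_⟩
      · simp only [Finset.mem_sdiff]; exact ⟨hx.2, hx'⟩
      · simp only [Finset.mem_sdiff, Finset.mem_union]; tauto
    exact_mod_cast Finset.card_lt_card this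

theorem card_execSet_le (MS : Finset M) (q : ℕ) (R : OracleAlg X Y (SK × VK) × Oracle X Y)
    (hq : ∀ j ∈ MS, (S.honest (R.1.run R.2) j).numQueries R.2 ≤ q) :
    (S.execSet MS R).card ≤ MS.card * q :=
  Finset.card_biUnion_le_card_mul _ _ _ fun j hj => (card_queries_le _ _).trans (hq j hj)

/-- Learn the answers to the queries of `b`, then continue as suggested by these answers. -/
theorem exists_record [Nonempty (M × Sig)] {A : Type*} {α : M} {X₀ : Finset X}
    (T : Finset (OracleAlg X Y (SK × VK) × Oracle X Y)) (p : OracleAlg X Y (SK × VK) → ℝ)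
    (b : OracleAlg X Y A) (O₀ : Oracle X Y) (n B : ℕ) (c : ℝ)
    (H : OracleAlg X Y (SK × VK) × Oracle X Y → ℝ)
    (hb : ∀ R ∈ T, b.numQueries R.2 ≤ n)
    (h : ∀ R₁ ∈ T, ∃ a : OracleAlg X Y (M × Sig),
      (∀ R ∈ T, (∀ x ∈ b.queries R₁.2, R₁.2 x = R.2 x) → a.numQueries R.2 ≤ B) ∧
      c * ∑ R ∈ T with (∀ x ∈ b.queries R₁.2, R₁.2 x = R.2 x), p R.1 * S.fail α X₀ a R ≤
        ∑ R ∈ T with (∀ x ∈ b.queries R₁.2, R₁.2 x = R.2 x), H R) :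
    ∃ a : OracleAlg X Y (M × Sig), (∀ R ∈ T, a.numQueries R.2 ≤ n + B) ∧
      c * ∑ R ∈ T, p R.1 * S.fail α X₀ a R ≤ ∑ R ∈ T, H R := by
  have : Nonempty (OracleAlg X Y (M × Sig)) := ⟨output (Classical.arbitrary _)⟩
  choose! f hf using h
  let key : OracleAlg X Y (SK × VK) × Oracle X Y → Oracle X Y :=
    fun R => Oracle.patch (b.queries R.2) R.2 O₀
  -- The table identifies the transcript class, and the continuation belongs to a chosen
  -- representative `R₁` of it. The default is never reached from `T`.
  let F : Oracle X Y → OracleAlg X Y (M × Sig) := fun O =>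
    if h : ∃ R₁ ∈ T, key R₁ = O then f h.choose else output (Classical.arbitrary _)
  have hF : ∀ R ∈ T, ∃ R₁ ∈ T, key R₁ = key R ∧ F (key R) = f R₁ := by
    intro R hR
    have hex : ∃ R₁ ∈ T, key R₁ = key R := ⟨R, hR, rfl⟩
    exact ⟨hex.choose, hex.choose_spec.1, hex.choose_spec.2, dif_pos hex⟩
  refine ⟨record F b O₀, ?_, ?_⟩
  · intro R hR
    obtain ⟨R₁, hR₁, hk, hFR⟩ := hF R hR
    rw [(run_record _ _ _ _).2]
    refine Nat.add_le_add (hb R hR) ?_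
    change (F (key R)).numQueries R.2 ≤ B
    rw [hFR]
    exact (hf R₁ hR₁).1 R hR ((patch_queries_eq_iff _ _ _ _).1 hk)
  · rw [← Finset.sum_fiberwise_of_maps_to (s := T) (t := T.image key) (g := key)
        (fun R hR => Finset.mem_image_of_mem _ hR) (fun R => p R.1 * _),
      ← Finset.sum_fiberwise_of_maps_to (s := T) (t := T.image key) (g := key)
        (fun R hR => Finset.mem_image_of_mem _ hR) H, Finset.mul_sum]
    refine Finset.sum_le_sum fun y hy => ?_
    obtain ⟨R₀, hR₀, rfl⟩ := Finset.mem_image.1 hy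
    obtain ⟨R₁, hR₁, hk, hFR⟩ := hF R₀ hR₀
    have hfilter : T.filter (fun R => key R = key R₀) =
        T.filter (fun R => ∀ x ∈ b.queries R₁.2, R₁.2 x = R.2 x) := by
      refine Finset.filter_congr fun R _ => ?_
      rw [← hk, ← patch_queries_eq_iff _ _ _ O₀, eq_comm]
    have hsum : ∑ R ∈ T with key R = key R₀, p R.1 * S.fail α X₀ (record F b O₀) R =
        ∑ R ∈ T with key R = key R₀, p R.1 * S.fail α X₀ (f R₁) R := by
      refine Finset.sum_congr rfl fun R hR => ?_
      rw [Finset.mem_filter] at hR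
      rw [S.fail_congr (a' := f R₁)]
      rw [(run_record _ _ _ _).1]
      change (F (key R)).run R.2 = _
      rw [hR.2, hFR]
    rw [hsum, hfilter]
    exact (hf R₁ hR₁).2

/-- A finite set of executions (coins of key generation and oracle), closed under mixing of the
oracles, on which the scheme is complete and efficient. -/
structure IsModel (MS : Finset M) (q : ℕ) (X₀ : Finset X)
    (Ω : Finset (OracleAlg X Y (SK × VK) × Oracle X Y)) (p : OracleAlg X Y (SK × VK) → ℝ) :
    Prop where
  pos : ∀ R ∈ Ω, 0 < p R.1
  patch_mem : ∀ R ∈ Ω, ∀ R' ∈ Ω, ∀ K : Set X, (R.1, Oracle.patch K R.2 R'.2) ∈ Ω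
  complete : ∀ R ∈ Ω, ∀ j ∈ MS, (S.ver (R.1.run R.2).2 j (S.view j R).2).run R.2 = true
  numQueries_le : ∀ R ∈ Ω, ∀ j ∈ MS,
    R.1.numQueries R.2 + (S.honest (R.1.run R.2) j).numQueries R.2 ≤ q
  verSet_subset : ∀ R ∈ Ω, ∀ j ∈ MS, S.verSet j R ⊆ X₀

namespace IsModel

variable {S} {MS : Finset M} {q : ℕ} {X₀ : Finset X}
  {Ω : Finset (OracleAlg X Y (SK × VK) × Oracle X Y)} {p : OracleAlg X Y (SK × VK) → ℝ}

theorem honest_le (h : S.IsModel MS q X₀ Ω p) {R} (hR : R ∈ Ω) {j : M} (hj : j ∈ MS) :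
    (S.honest (R.1.run R.2) j).numQueries R.2 ≤ q :=
  (Nat.le_add_left _ _).trans (h.numQueries_le R hR j hj)

theorem swap_mem (h : S.IsModel MS q X₀ Ω p) {α : M} {L : Finset X} {R₀ R R'}
    (hR : R ∈ Ω.filter (S.Rel α L R₀)) (hR' : R' ∈ Ω.filter (S.Rel α L R₀)) :
    (S.swap α L (R, R')).1 ∈ Ω.filter (S.Rel α L R₀) ∧
      (S.swap α L (R, R')).2 ∈ Ω.filter (S.Rel α L R₀) := by
  rw [Finset.mem_filter] at hR hR'
  simp only [Finset.mem_filter]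
  exact ⟨⟨h.patch_mem R hR.1 R' hR'.1 _, hR.2.trans (swap_fst R R').2⟩,
    ⟨h.patch_mem R' hR'.1 R hR.1 _, hR'.2.trans (swap_snd (hR.2.symm.trans hR'.2)).2⟩⟩

/-- Reindexing by the involution `swap`; the weights survive because they depend only on the coins,
which the exchange leaves alone. -/
theorem sum_swap (h : S.IsModel MS q X₀ Ω p) (α : M) (L : Finset X) (R₀)
    (F : (OracleAlg X Y (SK × VK) × Oracle X Y) × (OracleAlg X Y (SK × VK) × Oracle X Y) → ℝ) :
    ∑ P ∈ Ω.filter (S.Rel α L R₀) ×ˢ Ω.filter (S.Rel α L R₀),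
        p P.1.1 * p P.2.1 * F (S.swap α L P) =
      ∑ P ∈ Ω.filter (S.Rel α L R₀) ×ˢ Ω.filter (S.Rel α L R₀), p P.1.1 * p P.2.1 * F P := by
  have hmem : ∀ P ∈ Ω.filter (S.Rel α L R₀) ×ˢ Ω.filter (S.Rel α L R₀),
      S.swap α L P ∈ Ω.filter (S.Rel α L R₀) ×ˢ Ω.filter (S.Rel α L R₀) := fun P hP =>
    Finset.mem_product.2 (h.swap_mem (Finset.mem_product.1 hP).1 (Finset.mem_product.1 hP).2)
  have hinv : ∀ P ∈ Ω.filter (S.Rel α L R₀) ×ˢ Ω.filter (S.Rel α L R₀),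
      S.swap α L (S.swap α L P) = P := fun P hP => by
    obtain ⟨h1, h2⟩ := Finset.mem_product.1 hP
    exact swap_swap ((Finset.mem_filter.1 h1).2.symm.trans (Finset.mem_filter.1 h2).2)
  exact Finset.sum_nbij' (S.swap α L) (S.swap α L) hmem hmem hinv hinv fun P _ => rfl

theorem sum_fail_attack_le (h : S.IsModel MS q X₀ Ω p) (α : M) (L : Finset X) (R₀) (d : M × Sig) :
    ∑ P ∈ Ω.filter (S.Rel α L R₀) ×ˢ Ω.filter (S.Rel α L R₀),
        p P.1.1 * p P.2.1 * S.fail α X₀ (S.attack MS α L d P.2) P.1 ≤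
      ∑ P ∈ Ω.filter (S.Rel α L R₀) ×ˢ Ω.filter (S.Rel α L R₀),
        p P.1.1 * p P.2.1 * (S.hit MS α L P.1 P.2 + S.blockedInd MS α P.2) := by
  -- After moving hit and blocked to the exchanged pair, the inequality holds term by term by
  -- `forges_attack`.
  rw [← h.sum_swap α L R₀ fun P => S.hit MS α L P.1 P.2 + S.blockedInd MS α P.2]
  refine Finset.sum_le_sum fun P hP => ?_
  obtain ⟨h1, h2⟩ := Finset.mem_product.1 hP
  rw [Finset.mem_filter] at h1 h2
  refine mul_le_mul_of_nonneg_left ?_ (mul_nonneg (h.pos _ h1.1).le (h.pos _ h2.1).le)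
  have hm := h.patch_mem P.2 h2.1 P.1 h1.1 (S.secret α P.2)
  by_cases e1 : S.execSet MS (S.swap α L P).2 ∩ S.secret α (S.swap α L P).1 ⊆
      S.verSet α (S.swap α L P).1 ∪ L
  · by_cases e2 : S.Blocked MS α (S.swap α L P).2
    · simp only [fail, hit, blockedInd, e1, e2, if_true]
      split_ifs <;> norm_num
    · have := S.forges_attack (d := d) (h1.2.symm.trans h2.2) (h.complete _ hm)
        (h.verSet_subset _ hm) e1 e2
      simp only [fail, hit, blockedInd, e1, e2, if_true, if_false, this]
      norm_num
  · simp only [fail, hit, blockedInd, e1, if_false]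
    split_ifs <;> norm_num

theorem numQueries_attack_le (h : S.IsModel MS q X₀ Ω p) (α : M) (L : Finset X) (d : M × Sig)
    {R R'} (hR : R ∈ Ω) (hR' : R' ∈ Ω) :
    (S.attack MS α L d R').numQueries R.2 ≤ MS.card * q := by
  refine S.numQueries_attack_le MS α L d R' R.2 q fun j hj => ?_
  have := h.honest_le (h.patch_mem R' hR' R hR (S.secret α R')) hj
  simp only [keys_patch_secret] at this
  exact this

/-- Derandomization: some hypothetical execution does at least as well as a random one. -/
theorem exists_le_of_weighted (T : Finset (OracleAlg X Y (SK × VK) × Oracle X Y))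
    (hT : T.Nonempty) (hp : ∀ R ∈ T, 0 < p R.1)
    (f : OracleAlg X Y (SK × VK) × Oracle X Y → ℝ) (s : ℝ)
    (h : ∑ R ∈ T, p R.1 * f R ≤ (∑ R ∈ T, p R.1) * s) : ∃ R ∈ T, f R ≤ s := by
  rw [Finset.sum_mul] at h
  obtain ⟨R, hR, hle⟩ := Finset.exists_le_of_sum_le hT h
  exact ⟨R, hR, le_of_mul_le_mul_left hle (hp R hR)⟩

/-- Attack right away, with the most promising hypothetical execution. -/
theorem exists_attack (h : S.IsModel MS q X₀ Ω p) (α : M) (L : Finset X) (d : M × Sig) (R₀)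
    (hR₀ : R₀ ∈ Ω) : ∃ R' ∈ Ω.filter (S.Rel α L R₀),
      (∑ R ∈ Ω.filter (S.Rel α L R₀), p R.1) *
        ∑ R ∈ Ω.filter (S.Rel α L R₀), p R.1 * S.fail α X₀ (S.attack MS α L d R') R ≤
      ∑ R' ∈ Ω.filter (S.Rel α L R₀), p R'.1 *
        ∑ R ∈ Ω.filter (S.Rel α L R₀), p R.1 * S.hit MS α L R R' +
      (∑ R ∈ Ω.filter (S.Rel α L R₀), p R.1) *
        ∑ R ∈ Ω.filter (S.Rel α L R₀), p R.1 * S.blockedInd MS α R := by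
  have hsum := h.sum_fail_attack_le α L R₀ d
  have hne : (Ω.filter (S.Rel α L R₀)).Nonempty :=
    ⟨R₀, Finset.mem_filter.2 ⟨hR₀, Rel.refl⟩⟩
  have hp : ∀ R ∈ Ω.filter (S.Rel α L R₀), 0 < p R.1 :=
    fun R hR => h.pos R (Finset.mem_filter.1 hR).1
  revert hsum hne hp
  generalize Ω.filter (S.Rel α L R₀) = T
  intro hsum hne hp
  have hP : 0 < ∑ R ∈ T, p R.1 := Finset.sum_pos hp hne
  rw [Finset.sum_product_right, Finset.sum_product_right] at hsum
  obtain ⟨R', hR', hle⟩ := exists_le_of_weighted T hne hp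
    (fun R' => ∑ R ∈ T, p R.1 * S.fail α X₀ (S.attack MS α L d R') R)
    ((∑ R' ∈ T, p R'.1 * ∑ R ∈ T, p R.1 * S.hit MS α L R R' +
      (∑ R ∈ T, p R.1) * ∑ R ∈ T, p R.1 * S.blockedInd MS α R) / ∑ R ∈ T, p R.1) (by
    rw [mul_div_cancel₀ _ hP.ne']
    refine le_trans (le_of_eq ?_) (hsum.trans (le_of_eq ?_))
    · refine Finset.sum_congr rfl fun R' _ => ?_
      rw [Finset.mul_sum]
      exact Finset.sum_congr rfl fun R _ => by ring
    · rw [mul_comm (∑ R ∈ T, p R.1), Finset.sum_mul, ← Finset.sum_add_distrib]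
      refine Finset.sum_congr rfl fun R' _ => ?_
      rw [Finset.mul_sum, Finset.mul_sum, ← Finset.sum_add_distrib]
      exact Finset.sum_congr rfl fun R _ => by ring)
  exact ⟨R', hR', by rwa [le_div_iff₀' hP] at hle⟩

/-- Ask the queries of the most promising hypothetical execution. -/
theorem exists_learn (h : S.IsModel MS q X₀ Ω p) (α : M) (L : Finset X) (R₀)
    (hR₀ : R₀ ∈ Ω) : ∃ R' ∈ Ω.filter (S.Rel α L R₀),
      (∑ R ∈ Ω.filter (S.Rel α L R₀), p R.1) *
        ∑ R ∈ Ω.filter (S.Rel α L R₀), p R.1 * S.unknown α (L ∪ S.execSet MS R') R +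
      ∑ R' ∈ Ω.filter (S.Rel α L R₀), p R'.1 *
        ∑ R ∈ Ω.filter (S.Rel α L R₀), p R.1 * S.hit MS α L R R' ≤
      (∑ R ∈ Ω.filter (S.Rel α L R₀), p R.1) *
        ∑ R ∈ Ω.filter (S.Rel α L R₀), p R.1 * S.unknown α L R := by
  have hne : (Ω.filter (S.Rel α L R₀)).Nonempty :=
    ⟨R₀, Finset.mem_filter.2 ⟨hR₀, Rel.refl⟩⟩
  have hp : ∀ R ∈ Ω.filter (S.Rel α L R₀), 0 < p R.1 :=
    fun R hR => h.pos R (Finset.mem_filter.1 hR).1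
  revert hne hp
  generalize Ω.filter (S.Rel α L R₀) = T
  intro hne hp
  have hP : 0 < ∑ R ∈ T, p R.1 := Finset.sum_pos hp hne
  obtain ⟨R', hR', hle⟩ := exists_le_of_weighted T hne hp
    (fun R' => ∑ R ∈ T, p R.1 * S.unknown α (L ∪ S.execSet MS R') R)
    (((∑ R ∈ T, p R.1) * ∑ R ∈ T, p R.1 * S.unknown α L R -
      ∑ R' ∈ T, p R'.1 * ∑ R ∈ T, p R.1 * S.hit MS α L R R') / ∑ R ∈ T, p R.1) (by
    rw [mul_div_cancel₀ _ hP.ne', le_sub_iff_add_le, ← Finset.sum_add_distrib, Finset.sum_mul]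
    refine Finset.sum_le_sum fun R' hR' => ?_
    rw [← mul_add, ← Finset.sum_add_distrib]
    refine mul_le_mul_of_nonneg_left (Finset.sum_le_sum fun R hR => ?_) (hp R' hR').le
    rw [← mul_add]
    exact mul_le_mul_of_nonneg_left (S.unknown_add_hit_le MS α L R R') (hp R hR).le)
  exact ⟨R', hR', by rw [le_div_iff₀' hP] at hle; linarith⟩

theorem hit_le_unknown (L : Finset X) (α : M) (R R') : S.hit MS α L R R' ≤ S.unknown α L R :=
  (le_add_of_nonneg_left (Nat.cast_nonneg _)).trans (S.unknown_add_hit_le MS α L R R')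

/-- On a class of indistinguishable executions, some forger with `t + 1` rounds fails rarely. -/
theorem exists_forger_of_rel [Nonempty (M × Sig)] (h : S.IsModel MS q X₀ Ω p) (α : M) (t : ℕ) :
    ∀ (L : Finset X), ∀ R₀ ∈ Ω, ∃ a : OracleAlg X Y (M × Sig),
      (∀ R ∈ Ω.filter (S.Rel α L R₀), a.numQueries R.2 ≤ (t + 1) * (MS.card * q)) ∧
      ((t : ℝ) + 1) * ∑ R ∈ Ω.filter (S.Rel α L R₀), p R.1 * S.fail α X₀ a R ≤
        ∑ R ∈ Ω.filter (S.Rel α L R₀),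
          p R.1 * (S.unknown α L R + (t + 1) * S.blockedInd MS α R) := by
  have hsplit : ∀ (T : Finset (OracleAlg X Y (SK × VK) × Oracle X Y)) (L : Finset X) (c : ℝ),
      ∑ R ∈ T, p R.1 * (S.unknown α L R + c * S.blockedInd MS α R) =
        ∑ R ∈ T, p R.1 * S.unknown α L R + c * ∑ R ∈ T, p R.1 * S.blockedInd MS α R := by
    intro T L c
    rw [Finset.mul_sum, ← Finset.sum_add_distrib]
    exact Finset.sum_congr rfl fun R _ => by ring
  -- If the mean number of hits is at most 1/(t+1) of the mean number of unknown secret queries, an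
  -- immediate attack is good enough.
  have now : ∀ (t : ℕ) (L : Finset X), ∀ R₀ ∈ Ω,
      ((t : ℝ) + 1) * ∑ R' ∈ Ω.filter (S.Rel α L R₀), p R'.1 *
          ∑ R ∈ Ω.filter (S.Rel α L R₀), p R.1 * S.hit MS α L R R' ≤
        (∑ R ∈ Ω.filter (S.Rel α L R₀), p R.1) *
          ∑ R ∈ Ω.filter (S.Rel α L R₀), p R.1 * S.unknown α L R →
      ∃ a : OracleAlg X Y (M × Sig),
      (∀ R ∈ Ω.filter (S.Rel α L R₀), a.numQueries R.2 ≤ (t + 1) * (MS.card * q)) ∧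
      ((t : ℝ) + 1) * ∑ R ∈ Ω.filter (S.Rel α L R₀), p R.1 * S.fail α X₀ a R ≤
        ∑ R ∈ Ω.filter (S.Rel α L R₀),
          p R.1 * (S.unknown α L R + (t + 1) * S.blockedInd MS α R) := by
    intro t L R₀ hR₀ hle
    obtain ⟨R', hR', hf⟩ := h.exists_attack α L (Classical.arbitrary _) R₀ hR₀
    refine ⟨_, fun R hR => (h.numQueries_attack_le α L (Classical.arbitrary _)
      (Finset.mem_filter.1 hR).1 (Finset.mem_filter.1 hR').1).trans
        (Nat.le_mul_of_pos_left _ (Nat.succ_pos t)), ?_⟩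
    rw [hsplit]
    have hP : 0 < ∑ R ∈ Ω.filter (S.Rel α L R₀), p R.1 :=
      Finset.sum_pos (fun R hR => h.pos R (Finset.mem_filter.1 hR).1)
        ⟨R₀, Finset.mem_filter.2 ⟨hR₀, Rel.refl⟩⟩
    have ht : (0 : ℝ) < t + 1 := by positivity
    have hf' := mul_le_mul_of_nonneg_left hf ht.le
    refine le_of_mul_le_mul_left ?_ hP
    linarith
  induction t with
  | zero =>
    intro L R₀ hR₀
    -- In the last round the condition is automatic, since `hit` is at most `unknown`.
    refine now 0 L R₀ hR₀ ?_
    rw [Nat.cast_zero, zero_add, one_mul, Finset.sum_mul]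
    refine Finset.sum_le_sum fun R' hR' => mul_le_mul_of_nonneg_left ?_
      (h.pos R' (Finset.mem_filter.1 hR').1).le
    exact Finset.sum_le_sum fun R hR => mul_le_mul_of_nonneg_left (hit_le_unknown L α R R')
      (h.pos R (Finset.mem_filter.1 hR).1).le
  | succ t ih =>
    intro L R₀ hR₀
    by_cases hcase : (((t + 1 : ℕ) : ℝ) + 1) * ∑ R' ∈ Ω.filter (S.Rel α L R₀), p R'.1 *
          ∑ R ∈ Ω.filter (S.Rel α L R₀), p R.1 * S.hit MS α L R R' ≤
        (∑ R ∈ Ω.filter (S.Rel α L R₀), p R.1) *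
          ∑ R ∈ Ω.filter (S.Rel α L R₀), p R.1 * S.unknown α L R
    · exact now (t + 1) L R₀ hR₀ hcase
    obtain ⟨R', hR', hle⟩ := h.exists_learn α L R₀ hR₀
    rw [Finset.mem_filter] at hR'
    -- Learning the answers splits the class into classes of `Rel` with the larger known set, to
    -- which the induction hypothesis applies.
    have hfilter : ∀ R₁ ∈ Ω.filter (S.Rel α L R₀),
        (Ω.filter (S.Rel α L R₀)).filter (fun R => ∀ x ∈
          (askAll (Y := Y) (S.execSet MS R').toList).queries R₁.2, R₁.2 x = R.2 x) =
        Ω.filter (S.Rel α (L ∪ S.execSet MS R') R₁) := by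
      intro R₁ hR₁
      rw [Finset.mem_filter] at hR₁
      rw [Finset.filter_filter]
      refine Finset.filter_congr fun R _ => ?_
      rw [queries_askAll, Finset.toList_toFinset]
      constructor
      · rintro ⟨h1, h2⟩
        have h3 := hR₁.2.symm.trans h1
        refine ⟨h3.1, fun x hx => ?_⟩
        rw [← Finset.union_assoc, Finset.mem_union] at hx
        exact hx.elim (h3.2 x) (h2 x)
      · intro h1
        refine ⟨hR₁.2.trans ⟨h1.1, fun x hx => h1.2 x ?_⟩, fun x hx => h1.2 x ?_⟩
        · rw [← Finset.union_assoc]; exact Finset.mem_union_left _ hx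
        · rw [← Finset.union_assoc]; exact Finset.mem_union_right _ hx
    obtain ⟨a, ha, hfa⟩ := S.exists_record (X₀ := X₀) (α := α) (Ω.filter (S.Rel α L R₀)) p
      (askAll (Y := Y) (S.execSet MS R').toList) R'.2 (MS.card * q) ((t + 1) * (MS.card * q))
      ((t : ℝ) + 1)
      (fun R => p R.1 * (S.unknown α (L ∪ S.execSet MS R') R + (t + 1) * S.blockedInd MS α R))
      (fun R _ => by
        rw [numQueries_askAll, Finset.length_toList]
        exact S.card_execSet_le MS q R' fun j hj => h.honest_le hR'.1 hj)
      (fun R₁ hR₁ => by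
        obtain ⟨a, ha, hfa⟩ := ih (L ∪ S.execSet MS R') R₁ (Finset.mem_filter.1 hR₁).1
        rw [← hfilter R₁ hR₁] at ha hfa
        exact ⟨a, fun R hR hx => ha R (Finset.mem_filter.2 ⟨hR, hx⟩), hfa⟩)
    refine ⟨a, fun R hR => (ha R hR).trans (le_of_eq (by ring)), ?_⟩
    rw [hsplit] at hfa ⊢
    have hP : 0 < ∑ R ∈ Ω.filter (S.Rel α L R₀), p R.1 :=
      Finset.sum_pos (fun R hR => h.pos R (Finset.mem_filter.1 hR).1)
        ⟨R₀, Finset.mem_filter.2 ⟨hR₀, Rel.refl⟩⟩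
    revert hcase hle hfa hP
    push_cast
    generalize ∑ R ∈ Ω.filter (S.Rel α L R₀), p R.1 * S.fail α X₀ a R = f
    generalize ∑ R ∈ Ω.filter (S.Rel α L R₀), p R.1 * S.unknown α L R = u
    generalize ∑ R ∈ Ω.filter (S.Rel α L R₀), p R.1 * S.unknown α (L ∪ S.execSet MS R') R = u'
    generalize ∑ R ∈ Ω.filter (S.Rel α L R₀), p R.1 * S.blockedInd MS α R = b
    generalize ∑ R' ∈ Ω.filter (S.Rel α L R₀), p R'.1 *
      ∑ R ∈ Ω.filter (S.Rel α L R₀), p R.1 * S.hit MS α L R R' = β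
    generalize ∑ R ∈ Ω.filter (S.Rel α L R₀), p R.1 = P
    intro hcase hle hfa hP
    rw [not_le] at hcase
    have ht : (0 : ℝ) < t + 1 := by positivity
    -- Hits were frequent, so learning leaves at most the fraction (t+1)/(t+2) of the unknown
    -- queries: u'/(t+1) ≤ u/(t+2).
    have h1 : (t + 1 + 1) * (P * u') ≤ (t + 1) * (P * u) := by nlinarith
    have h2 : (t + 1 + 1) * u' ≤ (t + 1) * u := by
      refine le_of_mul_le_mul_left ?_ hP
      linarith
    refine le_of_mul_le_mul_left ?_ ht
    nlinarith

end IsModel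

end OracleSigScheme

/-! ### Counting blocked messages and choosing the requested message. -/

namespace OracleSigScheme

open scoped Classical
open OracleAlg

variable {X : Type u} {Y : X → Type v}
  {M : Type w₁} {SK : Type w₂} {VK : Type w₃} {Sig : Type w₄}

namespace IsModel

variable {S : OracleSigScheme X Y M SK VK Sig} {MS : Finset M} {q : ℕ} {X₀ : Finset X}
  {Ω : Finset (OracleAlg X Y (SK × VK) × Oracle X Y)} {p : OracleAlg X Y (SK × VK) → ℝ}

theorem card_secret_add_card_verSet_le (h : S.IsModel MS q X₀ Ω p) {R} (hR : R ∈ Ω) {α : M}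
    (hα : α ∈ MS) : (S.secret α R).card + (S.verSet α R).card ≤ q := by
  have h1 := h.numQueries_le R hR α hα
  have h2 : (S.secret α R).card ≤
      R.1.numQueries R.2 + (S.sign (R.1.run R.2).1 α).numQueries R.2 := by
    rw [secret_eq]
    exact (Finset.card_union_le _ _).trans
      (Nat.add_le_add (card_queries_le _ _) (card_queries_le _ _))
  have h3 : (S.verSet α R).card ≤
      (S.ver (S.view α R).1 α (S.view α R).2).numQueries R.2 := card_queries_le _ _
  rw [view_eq] at h3
  rw [honest, numQueries_bind] at h1
  simp only at h3
  omega

/-- For every execution, few messages are blocked. -/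
theorem sum_blockedInd_le (h : S.IsModel MS q X₀ Ω p) {R} (hR : R ∈ Ω) :
    ∑ α ∈ MS, S.blockedInd MS α R ≤ (q.choose (q / 2) : ℝ) := by
  simp only [blockedInd]
  rw [← Finset.sum_filter, Finset.sum_const, nsmul_eq_mul, mul_one]
  norm_cast
  -- Removing `verSet` from `secret` makes the pairs disjoint; being blocked is then exactly the
  -- cross-intersection condition.
  refine card_le_choose_half_of_cross_intersecting q _ (fun α => S.verSet α R)
    (fun α => S.secret α R \ S.verSet α R) (fun _ _ => Finset.disjoint_sdiff) ?_ ?_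
  · intro i hi j hj hji hdis
    rw [Finset.mem_filter] at hi hj
    refine hi.2 j hj.1 hji fun x hx => ?_
    rw [Finset.mem_inter] at hx
    by_contra hxV
    exact Finset.disjoint_left.1 hdis hx.1 (Finset.mem_sdiff.2 ⟨hx.2, hxV⟩)
  · intro i hi
    have h1 := h.card_secret_add_card_verSet_le hR (Finset.mem_filter.1 hi).1
    have h2 := Finset.card_le_card (Finset.sdiff_subset (s := S.secret i R) (t := S.verSet i R))
    omega

/-- A forger for the requested message `α`, given as a family of decision trees. -/
theorem exists_forger [Nonempty (M × Sig)] (h : S.IsModel MS q X₀ Ω p) (O₀ : Oracle X Y)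
    {α : M} (hα : α ∈ MS) (t : ℕ) : ∃ a : VK × Sig → OracleAlg X Y (M × Sig),
      (∀ R ∈ Ω, (a (S.view α R)).numQueries R.2 ≤ q + (t + 1) * (MS.card * q)) ∧
      ((t : ℝ) + 1) * ∑ R ∈ Ω, p R.1 * S.fail α X₀ (a (S.view α R)) R ≤
        q * ∑ R ∈ Ω, p R.1 + (t + 1) * ∑ R ∈ Ω, p R.1 * S.blockedInd MS α R := by
  have hz : ∀ z : VK × Sig, ∃ a : OracleAlg X Y (M × Sig),
      (∀ R ∈ Ω.filter (fun R => S.view α R = z),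
        a.numQueries R.2 ≤ q + (t + 1) * (MS.card * q)) ∧
      ((t : ℝ) + 1) * ∑ R ∈ Ω with S.view α R = z, p R.1 * S.fail α X₀ a R ≤
        ∑ R ∈ Ω with S.view α R = z, p R.1 * (q + (t + 1) * S.blockedInd MS α R) := by
    intro z
    have hfilter : ∀ R₁ ∈ Ω.filter (fun R => S.view α R = z),
        (Ω.filter (fun R => S.view α R = z)).filter (fun R => ∀ x ∈
          (S.ver z.1 α z.2).queries R₁.2, R₁.2 x = R.2 x) = Ω.filter (S.Rel α ∅ R₁) := by
      intro R₁ hR₁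
      obtain ⟨-, hz₁⟩ := Finset.mem_filter.1 hR₁
      rw [Finset.filter_filter]
      refine Finset.filter_congr fun R _ => ?_
      rw [Rel, Finset.union_empty, verSet, hz₁]
      exact and_congr_left fun _ => eq_comm
    -- Verifying the received signature, at the cost of q queries, splits the executions with view
    -- `z` into the classes of `Rel` with nothing else learned.
    refine S.exists_record (Ω.filter (fun R => S.view α R = z)) p (S.ver z.1 α z.2) O₀ q
      ((t + 1) * (MS.card * q)) ((t : ℝ) + 1) _ ?_ ?_
    · intro R hR
      obtain ⟨hRΩ, rfl⟩ := Finset.mem_filter.1 hR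
      have h1 := h.honest_le hRΩ hα
      rw [honest, numQueries_bind] at h1
      rw [view_eq]
      exact (Nat.le_add_left _ _).trans h1
    · intro R₁ hR₁
      obtain ⟨a, ha, hfa⟩ := h.exists_forger_of_rel α t ∅ R₁ (Finset.mem_filter.1 hR₁).1
      rw [← hfilter R₁ hR₁] at ha hfa
      refine ⟨a, fun R hR hx => ha R (Finset.mem_filter.2 ⟨hR, hx⟩), hfa.trans ?_⟩
      refine Finset.sum_le_sum fun R hR => ?_
      have hRΩ := (Finset.mem_filter.1 (Finset.mem_filter.1 hR).1).1
      refine mul_le_mul_of_nonneg_left ?_ (h.pos R hRΩ).le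
      have h1 := h.card_secret_add_card_verSet_le hRΩ hα
      have h2 : (S.secret α R \ (S.verSet α R ∪ ∅)).card ≤ q :=
        (Finset.card_le_card Finset.sdiff_subset).trans (by omega)
      have h3 : S.unknown α ∅ R ≤ q := by
        unfold unknown
        exact_mod_cast h2
      linarith
  choose a ha hfa using hz
  refine ⟨a, fun R hR => ha _ R (Finset.mem_filter.2 ⟨hR, rfl⟩), ?_⟩
  have e : (q : ℝ) * ∑ R ∈ Ω, p R.1 + (t + 1) * ∑ R ∈ Ω, p R.1 * S.blockedInd MS α R =
      ∑ R ∈ Ω, p R.1 * (q + (t + 1) * S.blockedInd MS α R) := by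
    rw [Finset.mul_sum, Finset.mul_sum, ← Finset.sum_add_distrib]
    exact Finset.sum_congr rfl fun R _ => by ring
  rw [e, ← Finset.sum_fiberwise_of_maps_to (s := Ω) (t := Ω.image (S.view α)) (g := S.view α)
      (fun R hR => Finset.mem_image_of_mem _ hR) (fun R => p R.1 * S.fail α X₀ _ R),
    ← Finset.sum_fiberwise_of_maps_to (s := Ω) (t := Ω.image (S.view α)) (g := S.view α)
      (fun R hR => Finset.mem_image_of_mem _ hR) (fun R => p R.1 * (q + _)), Finset.mul_sum]
  refine Finset.sum_le_sum fun z _ => le_trans (le_of_eq ?_) (hfa z)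
  congr 1
  exact Finset.sum_congr rfl fun R hR => by rw [(Finset.mem_filter.1 hR).2]

/-- Some requested message admits a forger that fails rarely. -/
theorem exists_msg_forger [Nonempty (M × Sig)] (h : S.IsModel MS q X₀ Ω p) (O₀ : Oracle X Y)
    (hMS : MS.Nonempty) (t : ℕ) :
    ∃ α ∈ MS, ∃ a : VK × Sig → OracleAlg X Y (M × Sig),
      (∀ R ∈ Ω, (a (S.view α R)).numQueries R.2 ≤ q + (t + 1) * (MS.card * q)) ∧
      ∑ R ∈ Ω, p R.1 * S.fail α X₀ (a (S.view α R)) R ≤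
        ((q : ℝ) / (t + 1) + q.choose (q / 2) / MS.card) * ∑ R ∈ Ω, p R.1 := by
  have hcard : (0 : ℝ) < MS.card := by exact_mod_cast Finset.card_pos.2 hMS
  -- The bound on blocked messages holds in each execution, so averaging over `MS` yields one `α`,
  -- fixed independently of the keys.
  obtain ⟨α, hα, hle⟩ : ∃ α ∈ MS, ∑ R ∈ Ω, p R.1 * S.blockedInd MS α R ≤
      (q.choose (q / 2) / MS.card) * ∑ R ∈ Ω, p R.1 := by
    refine Finset.exists_le_of_sum_le hMS ?_
    rw [Finset.sum_comm, Finset.sum_const, nsmul_eq_mul, ← mul_assoc,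
      mul_div_cancel₀ _ hcard.ne', Finset.mul_sum]
    refine Finset.sum_le_sum fun R hR => ?_
    rw [← Finset.mul_sum, mul_comm]
    exact mul_le_mul_of_nonneg_right (h.sum_blockedInd_le hR) (h.pos R hR).le
  obtain ⟨a, ha, hfa⟩ := h.exists_forger O₀ hα t
  refine ⟨α, hα, a, ha, ?_⟩
  have ht : (0 : ℝ) < t + 1 := by positivity
  refine le_of_mul_le_mul_left (hfa.trans ?_) ht
  have e : ∀ P c : ℝ, ((t : ℝ) + 1) * ((q / (t + 1) + c) * P) = q * P + (t + 1) * (c * P) := by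
    intro P c
    field_simp
  rw [e]
  have := mul_le_mul_of_nonneg_left hle ht.le
  linarith

end IsModel

end OracleSigScheme

/-! ### The random oracle restricted to finitely many positions. -/

section RandomOracle

open scoped Classical
open OracleAlg

variable {X : Type u} {Y : X → Type v}

/-- The oracles that agree with `O'` on `X₀`. -/
def Oracle.cylinder (X₀ : Finset X) (O' : Oracle X Y) : Set (Oracle X Y) :=
  {O | ∀ x ∈ X₀, O x = O' x}

theorem Oracle.cylinder_eq_pi (X₀ : Finset X) (O : Oracle X Y) :
    Oracle.cylinder X₀ O = @Set.pi X Y (X₀ : Set X) (fun x => {O x}) := by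
  ext O'
  exact Iff.rfl

theorem Oracle.measurableSet_cylinder (X₀ : Finset X) (O : Oracle X Y) :
    MeasurableSet (Oracle.cylinder X₀ O) := by
  rw [Oracle.cylinder_eq_pi]
  exact @MeasurableSet.pi X Y (fun _ => ⊤) (X₀ : Set X) _ X₀.countable_toSet
    fun _ _ => MeasurableSpace.measurableSet_top

/-- The oracle with the answers `o` on `X₀` and the answers of `O₀` elsewhere. -/
noncomputable def Oracle.extend (X₀ : Finset X) (O₀ : Oracle X Y) (o : ∀ x : X₀, Y x) :
    Oracle X Y :=
  fun x => if h : x ∈ X₀ then o ⟨x, h⟩ else O₀ x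

variable [∀ x, Fintype (Y x)]

/-- The oracles that agree with `O₀` outside `X₀`. -/
noncomputable def Oracle.extensions (X₀ : Finset X) (O₀ : Oracle X Y) : Finset (Oracle X Y) :=
  Finset.univ.image (Oracle.extend X₀ O₀)

theorem Oracle.mem_extensions {X₀ : Finset X} {O₀ O : Oracle X Y} :
    O ∈ Oracle.extensions X₀ O₀ ↔ ∀ x ∉ X₀, O x = O₀ x := by
  rw [Oracle.extensions, Finset.mem_image]
  constructor
  · rintro ⟨o, -, rfl⟩ x hx
    exact dif_neg hx
  · intro h
    refine ⟨fun x => O x, Finset.mem_univ _, funext fun x => ?_⟩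
    by_cases hx : x ∈ X₀
    · exact dif_pos hx
    · exact (dif_neg hx).trans (h x hx).symm

theorem Oracle.patch_mem_extensions (X₀ : Finset X) (O₀ O : Oracle X Y) :
    Oracle.patch X₀ O O₀ ∈ Oracle.extensions X₀ O₀ :=
  Oracle.mem_extensions.2 fun _ hx => Oracle.patch_of_notMem (by simpa using hx) _ _

theorem Oracle.patch_eq_iff {X₀ : Finset X} {O₀ O O' : Oracle X Y}
    (h : O' ∈ Oracle.extensions X₀ O₀) :
    Oracle.patch X₀ O O₀ = O' ↔ O ∈ Oracle.cylinder X₀ O' := by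
  rw [Oracle.mem_extensions] at h
  constructor
  · rintro rfl x hx
    exact (Oracle.patch_of_mem (by simpa using hx) _ _).symm
  · intro h'
    funext x
    by_cases hx : x ∈ X₀
    · rw [Oracle.patch_of_mem (by simpa using hx), h' x hx]
    · rw [Oracle.patch_of_notMem (by simpa using hx), h x hx]

variable [∀ x, Nonempty (Y x)]

theorem isProbabilityMeasure_uniformOfFintype (x : X) :
    @IsProbabilityMeasure (Y x) ⊤ (@PMF.toMeasure (Y x) ⊤ (PMF.uniformOfFintype (Y x))) :=
  @PMF.toMeasure.isProbabilityMeasure (Y x) ⊤ _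

instance isProbabilityMeasure_randomOracle : IsProbabilityMeasure (randomOracle X Y) :=
  @Measure.instIsProbabilityMeasureForallInfinitePi X Y (fun _ => ⊤) _
    isProbabilityMeasure_uniformOfFintype

theorem randomOracle_cylinder (X₀ : Finset X) (O : Oracle X Y) :
    randomOracle X Y (Oracle.cylinder X₀ O) =
      ∏ x ∈ X₀, (Fintype.card (Y x) : ℝ≥0∞)⁻¹ := by
  rw [Oracle.cylinder_eq_pi]
  refine (@Measure.infinitePi_pi X Y (fun _ => ⊤) _ isProbabilityMeasure_uniformOfFintype X₀
    (fun x => {O x}) fun _ _ => MeasurableSpace.measurableSet_top).trans ?_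
  refine Finset.prod_congr rfl fun x _ => ?_
  rw [@PMF.toMeasure_apply_singleton (Y x) ⊤ _ _ MeasurableSpace.measurableSet_top,
    PMF.uniformOfFintype_apply]

/-- Averages of functions that depend on finitely many answers only. -/
theorem lintegral_patch_randomOracle (X₀ : Finset X) (O₀ : Oracle X Y) (G : Oracle X Y → ℝ≥0∞) :
    ∫⁻ O, G (Oracle.patch X₀ O O₀) ∂(randomOracle X Y) =
      (∏ x ∈ X₀, (Fintype.card (Y x) : ℝ≥0∞)⁻¹) * ∑ O ∈ Oracle.extensions X₀ O₀, G O := by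
  -- The integrand is a finite combination of cylinder indicators, so `G` need not be measurable.
  have e : ∀ O : Oracle X Y, G (Oracle.patch X₀ O O₀) =
      ∑ O' ∈ Oracle.extensions X₀ O₀,
        (Oracle.cylinder X₀ O').indicator (fun _ => G O') O := by
    intro O
    rw [Finset.sum_eq_single (Oracle.patch X₀ O O₀)]
    · rw [Set.indicator_of_mem]
      exact (Oracle.patch_eq_iff (Oracle.patch_mem_extensions _ _ _)).1 rfl
    · intro O' hO' hne
      refine Set.indicator_of_notMem (fun hmem => hne ?_) _
      exact ((Oracle.patch_eq_iff hO').2 hmem).symm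
    · exact fun h => absurd (Oracle.patch_mem_extensions _ _ _) h
  simp_rw [e]
  rw [lintegral_finsetSum _ fun O' _ =>
    measurable_const.indicator (Oracle.measurableSet_cylinder X₀ O'), Finset.mul_sum]
  refine Finset.sum_congr rfl fun O' _ => ?_
  rw [lintegral_indicator_const (Oracle.measurableSet_cylinder X₀ O'),
    randomOracle_cylinder, mul_comm]

theorem prod_inv_mul_card_extensions (X₀ : Finset X) (O₀ : Oracle X Y) :
    (∏ x ∈ X₀, (Fintype.card (Y x) : ℝ≥0∞)⁻¹) * (Oracle.extensions X₀ O₀).card = 1 := by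
  have h := lintegral_patch_randomOracle X₀ O₀ fun _ => 1
  simpa using h.symm

end RandomOracle

theorem PMF.exists_finset_le_sum {α : Type*} (μ : PMF α) {η : ℝ} (hη : 0 < η) :
    ∃ Γ : Finset α, (∀ a ∈ Γ, a ∈ μ.support) ∧ 1 - η ≤ ∑ a ∈ Γ, (μ a).toReal ∧
      ∑ a ∈ Γ, (μ a).toReal ≤ 1 := by
  classical
  have hs : HasSum (fun a => (μ a).toReal) 1 := by
    have h := ENNReal.hasSum_toReal (f := μ) (by rw [μ.tsum_coe]; exact ENNReal.one_ne_top)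
    rwa [← ENNReal.tsum_toReal_eq (fun a => μ.apply_ne_top a), μ.tsum_coe,
      ENNReal.toReal_one] at h
  obtain ⟨Γ, hΓ⟩ := ((hs.eventually_const_lt (by linarith : 1 - η < 1))).exists
  refine ⟨Γ.filter (· ∈ μ.support), fun a ha => (Finset.mem_filter.1 ha).2, hΓ.le.trans ?_,
    sum_le_hasSum _ (fun _ _ => ENNReal.toReal_nonneg) hs⟩
  rw [Finset.sum_filter]
  refine Finset.sum_le_sum fun a _ => ?_
  split_ifs with h
  · exact le_rfl
  · rw [(μ.apply_eq_zero_iff a).2 h]; simp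

/-! ### From the finite model to the random oracle. -/

namespace OracleSigScheme

open scoped Classical
open OracleAlg

variable {X : Type u} {Y : X → Type v}
  {M : Type w₁} {SK : Type w₂} {VK : Type w₃} {Sig : Type w₄}

/-- All queries occurring in the honest executions with coins in `Γ` and messages in `MS`. -/
noncomputable def domain [∀ x, Fintype (Y x)] (S : OracleSigScheme X Y M SK VK Sig)
    (Γ : Finset (OracleAlg X Y (SK × VK))) (MS : Finset M) : Finset X :=
  Γ.biUnion fun g => g.nodes ∪ MS.biUnion fun j => g.leaves.biUnion fun k =>
    (S.sign k.1 j).nodes ∪ (S.sign k.1 j).leaves.biUnion fun σ => (S.ver k.2 j σ).nodes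

section Domain

variable [∀ x, Fintype (Y x)] {S : OracleSigScheme X Y M SK VK Sig}
  {Γ : Finset (OracleAlg X Y (SK × VK))} {MS : Finset M} {g : OracleAlg X Y (SK × VK)}

theorem queries_gen_subset_domain (hg : g ∈ Γ) (O : Oracle X Y) :
    g.queries O ⊆ S.domain Γ MS := fun _ hx =>
  Finset.mem_biUnion.2 ⟨g, hg, Finset.mem_union_left _ (queries_subset_nodes O g hx)⟩

theorem queries_sign_subset_domain (hg : g ∈ Γ) {j : M} (hj : j ∈ MS) (O : Oracle X Y) :
    (S.sign (g.run O).1 j).queries O ⊆ S.domain Γ MS := fun _ hx =>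
  Finset.mem_biUnion.2 ⟨g, hg, Finset.mem_union_right _ (Finset.mem_biUnion.2 ⟨j, hj,
    Finset.mem_biUnion.2 ⟨_, run_mem_leaves O g,
      Finset.mem_union_left _ (queries_subset_nodes O _ hx)⟩⟩)⟩

theorem verSet_subset_domain (hg : g ∈ Γ) {j : M} (hj : j ∈ MS) (O : Oracle X Y) :
    S.verSet j (g, O) ⊆ S.domain Γ MS := fun _ hx => by
  rw [verSet, view_eq] at hx
  exact Finset.mem_biUnion.2 ⟨g, hg, Finset.mem_union_right _ (Finset.mem_biUnion.2 ⟨j, hj,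
    Finset.mem_biUnion.2 ⟨_, run_mem_leaves O g, Finset.mem_union_right _
      (Finset.mem_biUnion.2 ⟨_, run_mem_leaves O _, queries_subset_nodes O _ hx⟩)⟩⟩)⟩

theorem isModel (hcomp : S.PerfectlyComplete) {q : ℕ} (hq : S.QueriesAtMost q)
    (hΓ : ∀ g ∈ Γ, g ∈ S.gen.support) (O₀ : Oracle X Y) :
    S.IsModel MS q (S.domain Γ MS) (Γ ×ˢ Oracle.extensions (S.domain Γ MS) O₀)
      (fun g => (S.gen g).toReal) where
  pos R hR := ENNReal.toReal_pos ((PMF.mem_support_iff _ _).1 (hΓ _ (Finset.mem_product.1 hR).1))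
    (PMF.apply_ne_top _ _)
  patch_mem R hR R' hR' K := by
    rw [Finset.mem_product, Oracle.mem_extensions] at *
    refine ⟨hR.1, fun x hx => ?_⟩
    by_cases hK : x ∈ K
    · exact (Oracle.patch_of_mem hK _ _).trans (hR.2 x hx)
    · exact (Oracle.patch_of_notMem hK _ _).trans (hR'.2 x hx)
  complete R hR j _ := by
    rw [view_eq]
    exact hcomp R.2 R.1 (hΓ _ (Finset.mem_product.1 hR).1) j
  numQueries_le R hR j _ := by
    have := hq R.2 R.1 (hΓ _ (Finset.mem_product.1 hR).1) j
    rw [honest, numQueries_bind]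
    omega
  verSet_subset R hR j hj := verSet_subset_domain (Finset.mem_product.1 hR).1 hj R.2

end Domain

/-- A family of decision trees that succeeds on many executions of a finite model gives a
forger. -/
theorem le_breakProb_of_family [∀ x, Fintype (Y x)] [∀ x, Nonempty (Y x)]
    (S : OracleSigScheme X Y M SK VK Sig) (Γ : Finset (OracleAlg X Y (SK × VK)))
    (MS : Finset M) (α : M) (hα : α ∈ MS) (T : ℕ) (O₀ : Oracle X Y)
    (a : VK × Sig → OracleAlg X Y (M × Sig))
    (ha : ∀ R ∈ Γ ×ˢ Oracle.extensions (S.domain Γ MS) O₀,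
      (a (S.view α R)).numQueries R.2 ≤ T) :
    ∃ F : Forger X Y M VK Sig, F.QueriesAtMost T ∧
      (∏ x ∈ S.domain Γ MS, (Fintype.card (Y x) : ℝ≥0∞)⁻¹) *
        ∑ O ∈ Oracle.extensions (S.domain Γ MS) O₀, ∑ g ∈ Γ, S.gen g *
          (if S.Forges α (S.domain Γ MS) (a (S.view α (g, O))) (g, O) then 1 else 0) ≤
      S.breakProb F := by
  set X₀ := S.domain Γ MS with hX₀
  -- Answering queries outside `X₀` by `O₀` makes the run with `O` imitate the run of `a` in the
  -- model. Truncation enforces the bound for all inputs and oracles and never takes effect on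
  -- executions of the model.
  let tree : VK → Sig → OracleAlg X Y (M × Sig) := fun vk σ =>
    ((a (vk, σ)).override (X₀ : Set X)ᶜ O₀).truncate (α, σ) T
  refine ⟨⟨α, fun vk σ => PMF.pure (tree vk σ)⟩, ?_, ?_⟩
  · intro vk σ b hb O
    rw [PMF.mem_support_pure_iff] at hb
    rw [hb]
    exact numQueries_truncate_le _ _ _ _
  · rw [← lintegral_patch_randomOracle X₀ O₀, breakProb]
    refine lintegral_mono fun O => ?_
    refine le_trans ?_ (ENNReal.sum_le_tsum Γ)
    refine Finset.sum_le_sum fun g hg => ?_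
    gcongr
    split_ifs with hF
    swap
    · exact zero_le
    set O' := Oracle.patch X₀ O O₀ with hO'
    have hagree : ∀ x ∈ X₀, O' x = O x := fun x hx => Oracle.patch_of_mem (by simpa using hx) _ _
    have hO'c : Oracle.patch (X₀ : Set X)ᶜ O₀ O = O' := by
      funext x
      by_cases hx : x ∈ (X₀ : Set X) <;> simp [Oracle.patch, hO', hx]
    have hkey : g.run O = g.run O' :=
      (run_congr g fun x hx => hagree x (queries_gen_subset_domain hg O' hx)).1.symm
    have hsig : (S.sign (g.run O).1 α).run O = (S.sign (g.run O').1 α).run O' := by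
      rw [hkey]
      exact (run_congr _ fun x hx => hagree x (queries_sign_subset_domain hg hα O' hx)).1.symm
    have hview : ((g.run O).2, (S.sign (g.run O).1 α).run O) = S.view α (g, O') := by
      rw [view_eq, hsig, hkey]
    have hrun : (tree (g.run O).2 ((S.sign (g.run O).1 α).run O)).run O =
        (a (S.view α (g, O'))).run O' := by
      have hn := ha (g, O') (Finset.mem_product.2 ⟨hg, Oracle.patch_mem_extensions X₀ O₀ O⟩)
      change (((a ((g.run O).2, (S.sign (g.run O).1 α).run O)).override (X₀ : Set X)ᶜ O₀).truncate
        _ T).run O = _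
      rw [hview, run_truncate, run_override, hO'c]
      refine (numQueries_override_le _ _ _ _).trans ?_
      rw [hO'c]
      exact hn
    obtain ⟨h1, h2, h3⟩ := hF
    -- Here the clause of `Forges` on verification queries is needed: `O` and `O'` agree only on
    -- `X₀`.
    have hver := run_congr (O := O') (O' := O) _ fun x hx => hagree x (h3 hx)
    have hsucc : (((tree (g.run O).2 ((S.sign (g.run O).1 α).run O)).run O).1 ≠ α ∧
        (S.ver (g.run O).2 ((tree (g.run O).2 ((S.sign (g.run O).1 α).run O)).run O).1
          ((tree (g.run O).2 ((S.sign (g.run O).1 α).run O)).run O).2).run O = true) := by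
      rw [hrun, hkey, ← hver.1]
      exact ⟨h1, h2⟩
    refine le_trans ?_ (ENNReal.le_tsum (tree (g.run O).2 ((S.sign (g.run O).1 α).run O)))
    simp only [PMF.pure_apply, if_true, one_mul]
    rw [if_pos hsucc]

/-- The trivial forger. -/
theorem exists_forger_zero [∀ x, Fintype (Y x)] [∀ x, Nonempty (Y x)]
    (S : OracleSigScheme X Y M SK VK Sig) (m : M) {lam δ : ℝ} (h : 1 ≤ lam + δ) :
    ∃ F : Forger X Y M VK Sig, F.QueriesAtMost 0 ∧
      ENNReal.ofReal (1 - (lam + δ)) ≤ S.breakProb F := by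
  refine ⟨⟨m, fun _ σ => PMF.pure (output (m, σ))⟩, ?_, ?_⟩
  · intro vk σ b hb O
    rw [PMF.mem_support_pure_iff] at hb
    rw [hb]
    exact le_rfl
  · rw [ENNReal.ofReal_of_nonpos (by linarith)]
    exact zero_le

theorem nonempty_sig [∀ x, Nonempty (Y x)] (S : OracleSigScheme X Y M SK VK Sig) (m : M) :
    Nonempty Sig := by
  obtain ⟨g, -⟩ := S.gen.support_nonempty
  let O : Oracle X Y := fun x => Classical.arbitrary (Y x)
  exact ⟨(S.sign (g.run O).1 m).run O⟩

/-- The forger for a message set of given size and a given number of rounds. -/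
theorem exists_forger_rounds [∀ x, Fintype (Y x)] [∀ x, Nonempty (Y x)]
    (S : OracleSigScheme X Y M SK VK Sig) (hcomp : S.PerfectlyComplete) {q : ℕ}
    (hq : S.QueriesAtMost q) (MS : Finset M) (hMS : MS.Nonempty) (t : ℕ) {η : ℝ} (hη : 0 < η) :
    ∃ F : Forger X Y M VK Sig, F.QueriesAtMost (q + (t + 1) * (MS.card * q)) ∧
      ENNReal.ofReal (1 - ((q : ℝ) / (t + 1) + q.choose (q / 2) / MS.card + η)) ≤
        S.breakProb F := by
  obtain ⟨m, hm⟩ := hMS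
  have := S.nonempty_sig m
  have : Nonempty (M × Sig) := ⟨(m, Classical.arbitrary Sig)⟩
  let O₀ : Oracle X Y := fun x => Classical.arbitrary (Y x)
  obtain ⟨Γ, hΓ, hmass, hmass'⟩ := S.gen.exists_finset_le_sum hη
  obtain ⟨α, hα, a, ha, hfa⟩ := (S.isModel (MS := MS) hcomp hq hΓ O₀).exists_msg_forger O₀
    ⟨m, hm⟩ t
  obtain ⟨F, hF, hle⟩ := S.le_breakProb_of_family Γ MS α hα _ O₀ a ha
  refine ⟨F, hF, le_trans ?_ hle⟩
  set ε : ℝ := (q : ℝ) / (t + 1) + q.choose (q / 2) / MS.card with hε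
  have hε0 : 0 ≤ ε := by positivity
  set X₀ := S.domain Γ MS
  set E := Oracle.extensions X₀ O₀
  have hterm : ∀ O g, S.gen g * (if S.Forges α X₀ (a (S.view α (g, O))) (g, O) then 1 else 0) =
      ENNReal.ofReal ((S.gen g).toReal * (1 - S.fail α X₀ (a (S.view α (g, O))) (g, O))) := by
    intro O g
    rw [ENNReal.ofReal_mul ENNReal.toReal_nonneg, ENNReal.ofReal_toReal (PMF.apply_ne_top _ _)]
    unfold fail
    split_ifs <;> simp
  have hnonneg : ∀ O g,
      0 ≤ (S.gen g).toReal * (1 - S.fail α X₀ (a (S.view α (g, O))) (g, O)) := by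
    intro O g
    refine mul_nonneg ENNReal.toReal_nonneg ?_
    unfold fail
    split_ifs <;> norm_num
  have hsum : ∑ O ∈ E, ∑ g ∈ Γ, S.gen g *
      (if S.Forges α X₀ (a (S.view α (g, O))) (g, O) then 1 else 0) =
      ENNReal.ofReal (∑ O ∈ E, ∑ g ∈ Γ,
        (S.gen g).toReal * (1 - S.fail α X₀ (a (S.view α (g, O))) (g, O))) := by
    rw [ENNReal.ofReal_sum_of_nonneg fun O _ => Finset.sum_nonneg fun g _ => hnonneg O g]
    refine Finset.sum_congr rfl fun O _ => ?_
    rw [ENNReal.ofReal_sum_of_nonneg fun g _ => hnonneg O g]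
    exact Finset.sum_congr rfl fun g _ => hterm O g
  have hreal : (E.card : ℝ) * (1 - (ε + η)) ≤ ∑ O ∈ E, ∑ g ∈ Γ,
      (S.gen g).toReal * (1 - S.fail α X₀ (a (S.view α (g, O))) (g, O)) := by
    have hconst : ∑ O ∈ E, ∑ g ∈ Γ, (S.gen g).toReal =
        E.card * ∑ g ∈ Γ, (S.gen g).toReal := by
      rw [Finset.sum_const, nsmul_eq_mul]
    rw [Finset.sum_product_right, Finset.sum_product_right] at hfa
    simp only [mul_sub, mul_one, Finset.sum_sub_distrib]
    simp only at hfa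
    rw [hconst] at hfa ⊢
    -- The mass m of `Γ` satisfies 1 - η ≤ m ≤ 1, so m - εm ≥ 1 - η - ε.
    have h1 : 1 - (ε + η) ≤ (1 - ε) * ∑ g ∈ Γ, (S.gen g).toReal := by nlinarith
    have h2 := mul_le_mul_of_nonneg_left h1 (Nat.cast_nonneg (α := ℝ) E.card)
    linarith
  rw [hsum]
  calc ENNReal.ofReal (1 - (ε + η))
      = (∏ x ∈ X₀, (Fintype.card (Y x) : ℝ≥0∞)⁻¹) *
          ENNReal.ofReal ((E.card : ℝ) * (1 - (ε + η))) := by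
        rw [ENNReal.ofReal_mul (Nat.cast_nonneg _), ENNReal.ofReal_natCast, ← mul_assoc,
          prod_inv_mul_card_extensions, one_mul]
    _ ≤ _ := by gcongr

end OracleSigScheme

/-! ### Choice of parameters and the final bounds. -/

theorem sq_mul_choose_half_le (q : ℕ) :
    (q : ℝ) ^ 2 * (q.choose (q / 2) : ℝ) ≤ (q : ℝ) ^ (3 / 2 : ℝ) * 2 ^ q := by
  have e : (q : ℝ) ^ 2 = (q : ℝ) ^ (3 / 2 : ℝ) * Real.sqrt q := by
    rw [Real.sqrt_eq_rpow, ← Real.rpow_add_of_nonneg (Nat.cast_nonneg q) (by norm_num)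
      (by norm_num), ← Real.rpow_natCast]
    norm_num
  rw [e, mul_assoc, mul_comm (Real.sqrt _)]
  exact mul_le_mul_of_nonneg_left (choose_half_mul_sqrt_le q) (by positivity)

/-- Since N/λ and, for q > 0, q/δ are at least 1, the roundings cost constant factors: n ≤ 2N/λ and
t + 1 ≤ 4q/δ. The constant is 9 = 4 · 2 + 1, the last unit paying for the initial q. The argument
gives δ in the denominator, and δ < 1 allows δ². -/
theorem rounds_mul_size_le {q n t : ℕ} {N lam δ : ℝ} (hlam : 0 < lam) (hlam1 : lam < 1)
    (hδ : 0 < δ) (hδ1 : δ < 1) (hN : 1 ≤ N) (hn : (n : ℝ) < N / lam + 1)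
    (ht : (t : ℝ) < 2 * q / δ + 1) :
    (q : ℝ) + (t + 1) * (n * q) ≤ 9 * ((q : ℝ) ^ 2 * N / (lam * δ ^ 2)) := by
  rcases Nat.eq_zero_or_pos q with rfl | hq
  · simp
  have hq1 : (1 : ℝ) ≤ q := by exact_mod_cast hq
  have hN1 : 1 ≤ N / lam := by rw [le_div_iff₀ hlam]; linarith
  have hq2 : 1 ≤ q / δ := by rw [le_div_iff₀ hδ]; linarith
  have h1 : (t : ℝ) + 1 ≤ 4 * (q / δ) := by
    rw [mul_div_assoc] at ht
    linarith
  have h2 : (n : ℝ) ≤ 2 * (N / lam) := by linarith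
  have h3 : ((t : ℝ) + 1) * (n * q) ≤ 4 * (q / δ) * (2 * (N / lam) * q) := by
    gcongr
  have h4 : (q : ℝ) ≤ (q / δ) * ((N / lam) * q) := by
    have := one_le_mul_of_one_le_of_one_le hq2 hN1
    nlinarith
  have h5 : (q : ℝ) + (t + 1) * (n * q) ≤ 9 * ((q / δ) * ((N / lam) * q)) := by linarith
  have h6 : (q / δ) * ((N / lam) * q) = (q : ℝ) ^ 2 * N / (lam * δ) := by
    field_simp
  rw [h6] at h5
  refine h5.trans ?_
  gcongr
  nlinarith

theorem mainTheorem1 :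
    ∃ C : ℝ, 0 < C ∧
      ∀ (X : Type u) (Y : X → Type v) [∀ x, Fintype (Y x)] [∀ x, Nonempty (Y x)]
        (M : Type w₁) (SK : Type w₂) (VK : Type w₃) (Sig : Type w₄) [Fintype M]
        (S : OracleSigScheme X Y M SK VK Sig) (q : ℕ) (lam δ : ℝ),
        0 < lam → 0 < δ →
        S.PerfectlyComplete →
        S.QueriesAtMost q →
        (q.choose (q / 2) : ℝ) / lam ≤ (Fintype.card M : ℝ) →
        ∃ (F : Forger X Y M VK Sig) (T : ℕ),
          F.QueriesAtMost T ∧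
          (T : ℝ) ≤ C * ((q : ℝ) ^ 2 * (q.choose (q / 2) : ℝ) / (lam * δ ^ 2)) ∧
          (T : ℝ) ≤ C * ((q : ℝ) ^ (3 / 2 : ℝ) * 2 ^ q / (lam * δ ^ 2)) ∧
          ENNReal.ofReal (1 - (lam + δ)) ≤ S.breakProb F := by
  refine ⟨9, by norm_num, ?_⟩
  intro X Y _ _ M SK VK Sig _ S q lam δ hlam hδ hcomp hq hM
  have hN : (1 : ℝ) ≤ q.choose (q / 2) := by
    exact_mod_cast Nat.choose_pos (Nat.div_le_self _ _)
  suffices h : ∃ (F : Forger X Y M VK Sig) (T : ℕ), F.QueriesAtMost T ∧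
      (T : ℝ) ≤ 9 * ((q : ℝ) ^ 2 * (q.choose (q / 2) : ℝ) / (lam * δ ^ 2)) ∧
      ENNReal.ofReal (1 - (lam + δ)) ≤ S.breakProb F by
    obtain ⟨F, T, h1, h2, h3⟩ := h
    refine ⟨F, T, h1, h2, h2.trans ?_, h3⟩
    have := sq_mul_choose_half_le q
    gcongr
  -- Otherwise λ and δ are both below 1, as `rounds_mul_size_le` requires.
  by_cases htriv : 1 ≤ lam + δ
  · have hpos : (0 : ℝ) < Fintype.card M := lt_of_lt_of_le (by positivity) hM
    obtain ⟨m⟩ := Fintype.card_pos_iff.1 (by exact_mod_cast hpos : 0 < Fintype.card M)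
    obtain ⟨F, h1, h2⟩ := S.exists_forger_zero m htriv
    exact ⟨F, 0, h1, by rw [Nat.cast_zero]; positivity, h2⟩
  rw [not_le] at htriv
  -- The cost grows with the number of messages tried, so only as many are kept as bring the blocked
  -- fraction down to λ.
  set n := ⌈(q.choose (q / 2) : ℝ) / lam⌉₊ with hn
  obtain ⟨MS, -, hMS⟩ := Finset.exists_subset_card_eq
    (s := (Finset.univ : Finset M)) (n := n) (by rw [Finset.card_univ]; exact Nat.ceil_le.2 hM)
  have hn0 : 0 < n := Nat.ceil_pos.2 (by positivity)
  have hnle : (q.choose (q / 2) : ℝ) / lam ≤ n := Nat.le_ceil _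
  -- Half of δ is spent on q/(t+1), the other half on the discarded coins.
  set t := ⌈2 * (q : ℝ) / δ⌉₊ with ht
  have htle : 2 * (q : ℝ) / δ ≤ t := Nat.le_ceil _
  obtain ⟨F, hF, hbreak⟩ := S.exists_forger_rounds hcomp hq MS
    (Finset.card_pos.1 (by rw [hMS]; exact hn0)) t (half_pos hδ)
  rw [hMS] at hF hbreak
  refine ⟨F, _, hF, ?_, le_trans (ENNReal.ofReal_le_ofReal ?_) hbreak⟩
  · push_cast
    exact rounds_mul_size_le hlam (by linarith) hδ (by linarith) hN
      (Nat.ceil_lt_add_one (by positivity)) (Nat.ceil_lt_add_one (by positivity))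
  · have h1 : (q.choose (q / 2) : ℝ) / n ≤ lam := by
      rw [div_le_iff₀ (by exact_mod_cast hn0)]
      rwa [div_le_iff₀' hlam] at hnle
    have h2 : (q : ℝ) / (t + 1) ≤ δ / 2 := by
      rw [div_le_iff₀ hδ] at htle
      rw [div_le_iff₀ (by positivity)]
      nlinarith
    linarith
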